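/- Let $\Gamma$ be a locally compact (Hausdorff, not necessarily second countable) amenable group with left Haar measure $|\cdot|$, and let $X$ be a probability space. Let $G$ be a group of unitary operators on $L^2(X)$ all of whose elements act as isometric algebra homomorphisms on $L^\infty(X)$, endowed with a filtration of finite length $d$, that is, subgroups $G=G_0=G_1\ge G_2\ge\dots\ge G_{d+1}=\{1\}$ (with $G_i=\{1\}$ for $i>d$) such that $[G_i,G_k]\subseteq G_{i+k}$ for all $i,k$. A map $g\colon\Gamma\to G_0$ is called polynomial with respect to a sequence $G_0\ge G_1\ge\dots$ of subgroups that is eventually trivial if, recursively, either $G_0$ is trivial, or for all $a,b\in\Gamma$ the map $m\mapsto g(m)^{-1}g(amb)$ is polynomial with respect to the shifted sequence $G_1\ge G_2\ge\dots$. A map $g\colon\Gamma\to G$ is called measurable if for every $f\in L^2(X)$ the maps $m\mapsto g(m)f$ and $m\mapsto g(m)^{-1}f$ from $\Gamma$ to $L^2(X)$ are strongly measurable, up to null sets, on every compact set (if $L^2(X)$ is separable, this holds in particular for every $g$ that is Borel measurable for the strong operator topology). A Følner net is a net $(\Phi_\alpha)_{\alpha\in A}$ of compact subsets of $\Gamma$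 of positive measure such that $\lim_\alpha\sup_{l\in K}|l\Phi_\alpha\,\Delta\,\Phi_\alpha|/|\Phi_\alpha|=0$ for every compact $K\subseteq\Gamma$. Let $j\ge 0$, let $g_1,\dots,g_j\colon\Gamma\to G$ be measurable polynomial maps, and let $f_0,\dots,f_j\in L^\infty(X)$. Then $m\mapsto f_0\cdot g_1(m)f_1\cdots g_j(m)f_j\in L^2(X)$ is integrable over compact subsets of $\Gamma$, and for every Følner net $(\Phi_\alpha)_{\alpha\in A}$ in $\Gamma$ and any choice of $(a_\alpha)_{\alpha\in A}\subseteq\Gamma$ the limit \[ \lim_\alpha \frac{1}{|a_\alpha\Phi_\alpha|}\int_{a_\alpha\Phi_\alpha} f_0\cdot g_1(m)f_1\cdots g_j(m)f_j\,\mathrm{d}m \] exists in $L^2(X)$ and is independent of the Følner net $(\Phi_\alpha)_{\alpha\in A}$ and of the shifts $(a_\alpha)_{\alpha\in A}$. -/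

import Mathlib

open MeasureTheory Filter Topology
open scoped ENNReal Pointwise symmDiff

/-! ### Filtrations and polynomial maps -/

section Polynomial

/-- A filtration `N₀ = N₁ ≥ N₂ ≥ …` on the group `N₀`, all `Nᵢ` being subgroups of an ambient
group `N`, with `[Nᵢ, Nⱼ] ⊆ Nᵢ₊ⱼ`. -/
structure IsGroupFiltration {N : Type*} [Group N] (F : ℕ → Subgroup N) : Prop where
  antitone : Antitone F
  commutator_le : ∀ i j, ⁅F i, F j⁆ ≤ F (i + j)
  zero_eq_one : F 0 = F 1

/-- `IsPolynomial n F g`: the map `g : Γ → F 0` is polynomial with respect to the prefiltration `F`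
of length `n - 1` (so `F n` is trivial; `n = 0` stands for length `-∞`, where `F 0` is trivial).
This is a recursion on the length: all discrete derivatives `m ↦ g(m)⁻¹ g(amb)` have to be
polynomial with respect to the shifted prefiltration `i ↦ F (i + 1)`. -/
def IsPolynomial {Γ N : Type*} [Group Γ] [Group N] :
    ℕ → (ℕ → Subgroup N) → (Γ → N) → Prop
  | 0, _, g => ∀ m, g m = 1
  | n + 1, F, g => (∀ m, g m ∈ F 0) ∧
      ∀ a b : Γ, IsPolynomial n (fun i => F (i + 1)) (fun m => (g m)⁻¹ * g (a * m * b))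

end Polynomial

/-! ### Følner nets -/

/-- A Følner net in a locally compact group `Γ` with left Haar measure `μ`: a net of compact sets
of positive (so that the quotient is meaningful; in particular they are nonempty) measure with
`sup_{l ∈ K} |l Φ_α ∆ Φ_α| / |Φ_α| → 0` for every compact `K`.
A locally compact group is amenable if and only if such a net exists. -/
structure IsFolnerNet {Γ : Type*} [Group Γ] [TopologicalSpace Γ] [MeasurableSpace Γ]
    (μ : Measure Γ) {A : Type*} [Preorder A] (Φ : A → Set Γ) : Prop where
  isCompact : ∀ α, IsCompact (Φ α)
  measure_ne_zero : ∀ α, μ (Φ α) ≠ 0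
  tendsto : ∀ K : Set Γ, IsCompact K →
    Tendsto (fun α => ⨆ l ∈ K, μ ((l • Φ α) ∆ Φ α) / μ (Φ α)) atTop (𝓝 0)

/-! ### Unitary operators acting on bounded functions -/

section Koopman

variable {X : Type*} [MeasurableSpace X]

/-- The inclusion `L^∞(X) ⊆ L²(X)` over a probability space. -/
noncomputable def linftyToL2 {P : Measure X} [IsProbabilityMeasure P] (f : Lp ℂ ∞ P) :
    Lp ℂ 2 P :=
  ((Lp.memLp f).mono_exponent le_top).toLp f

/-- The unitary operator `T` on `L²(X)` maps `L^∞(X)` to itself, preserving the norm of `L^∞(X)`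
and products (the product of `f` and `h` in `L^∞(X)` is written `f • h` in Mathlib). -/
structure ActsOnLinfty {P : Measure X} [IsProbabilityMeasure P]
    (T : Lp ℂ 2 P ≃ₗᵢ[ℂ] Lp ℂ 2 P) : Prop where
  memLp_top : ∀ f : Lp ℂ ∞ P, MemLp (T (linftyToL2 f)) ∞ P
  isometric : ∀ f : Lp ℂ ∞ P, eLpNorm (T (linftyToL2 f)) ∞ P = eLpNorm f ∞ P
  map_mul : ∀ f h : Lp ℂ ∞ P,
    T (linftyToL2 (f • h : Lp ℂ ∞ P)) =ᵐ[P] fun x => T (linftyToL2 f) x * T (linftyToL2 h) x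

theorem coeFn_linftyToL2 {P : Measure X} [IsProbabilityMeasure P] (f : Lp ℂ ∞ P) :
    linftyToL2 f =ᵐ[P] f :=
  MemLp.coeFn_toLp _

theorem linftyToL2_toLp {P : Measure X} [IsProbabilityMeasure P] (u : Lp ℂ 2 P)
    (hu : MemLp u ∞ P) : linftyToL2 (hu.toLp u) = u :=
  Lp.ext ((coeFn_linftyToL2 _).trans hu.coeFn_toLp)

theorem ActsOnLinfty.one {P : Measure X} [IsProbabilityMeasure P] :
    ActsOnLinfty (1 : Lp ℂ 2 P ≃ₗᵢ[ℂ] Lp ℂ 2 P) where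
  memLp_top f := (memLp_congr_ae (coeFn_linftyToL2 f)).2 (Lp.memLp f)
  isometric f := eLpNorm_congr_ae (coeFn_linftyToL2 f)
  map_mul f h := by
    filter_upwards [coeFn_linftyToL2 f, coeFn_linftyToL2 h,
      coeFn_linftyToL2 (f • h : Lp ℂ ∞ P), Lp.coeFn_lpSMul (r := ∞) f h] with x h1 h2 h3 h4
    simp only [LinearIsometryEquiv.coe_one, id_eq]
    rw [h1, h2, h3, h4]
    rfl

theorem ActsOnLinfty.mul {P : Measure X} [IsProbabilityMeasure P]
    {S T : Lp ℂ 2 P ≃ₗᵢ[ℂ] Lp ℂ 2 P} (hS : ActsOnLinfty S) (hT : ActsOnLinfty T) :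
    ActsOnLinfty (S * T) where
  memLp_top f := by
    have := hS.memLp_top ((hT.memLp_top f).toLp _)
    rwa [linftyToL2_toLp] at this
  isometric f := by
    have := hS.isometric ((hT.memLp_top f).toLp _)
    rw [linftyToL2_toLp] at this
    exact this.trans ((eLpNorm_congr_ae (hT.memLp_top f).coeFn_toLp).trans (hT.isometric f))
  map_mul f h := by
    have key := hS.map_mul ((hT.memLp_top f).toLp _) ((hT.memLp_top h).toLp _)
    have e : linftyToL2 ((hT.memLp_top f).toLp _ • (hT.memLp_top h).toLp _ : Lp ℂ ∞ P)
        = T (linftyToL2 (f • h : Lp ℂ ∞ P)) := by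
      refine Lp.ext ?_
      filter_upwards [hT.map_mul f h, (hT.memLp_top f).coeFn_toLp, (hT.memLp_top h).coeFn_toLp,
        coeFn_linftyToL2 ((hT.memLp_top f).toLp _ • (hT.memLp_top h).toLp _ : Lp ℂ ∞ P),
        Lp.coeFn_lpSMul (r := ∞) ((hT.memLp_top f).toLp _) ((hT.memLp_top h).toLp _)]
        with x h1 h2 h3 h4 h5
      rw [h1, h4, h5, ← h2, ← h3]
      rfl
    rw [e, linftyToL2_toLp, linftyToL2_toLp] at key
    exact key

/-- The group of all unitary operators on `L²(X)` that, together with their inverses, act as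
isometric algebra homomorphisms on `L^∞(X)`. Its subgroups are the groups of unitary operators on
`L²(X)` all of whose elements act as isometric algebra homomorphisms on `L^∞(X)`. -/
def koopmanGroup (P : Measure X) [IsProbabilityMeasure P] :
    Subgroup (Lp ℂ 2 P ≃ₗᵢ[ℂ] Lp ℂ 2 P) where
  carrier := {T | ActsOnLinfty T ∧ ActsOnLinfty T⁻¹}
  one_mem' := ⟨ActsOnLinfty.one, by simpa using ActsOnLinfty.one⟩
  mul_mem' := fun hS hT => ⟨hS.1.mul hT.1, by simpa [mul_inv_rev] using hT.2.mul hS.2⟩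
  inv_mem' := fun hT => ⟨hT.2, by simpa using hT.1⟩

theorem memLp_multipleProduct {P : Measure X} [IsProbabilityMeasure P] {j : ℕ}
    (T : Fin j → koopmanGroup P) (f : Fin (j + 1) → Lp ℂ ∞ P) :
    MemLp (fun x => f 0 x * ∏ i : Fin j, (T i).1 (linftyToL2 (f i.succ)) x) 2 P := by
  have h : MemLp (fun x => ∏ i : Fin j, (T i).1 (linftyToL2 (f i.succ)) x) ∞ P := by
    have aux : ∀ s : Finset (Fin j),
        MemLp (fun x => ∏ i ∈ s, (T i).1 (linftyToL2 (f i.succ)) x) ∞ P := by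
      intro s
      induction s using Finset.cons_induction with
      | empty => simpa using memLp_top_const (μ := P) (1 : ℂ)
      | cons i s hi ih =>
        simp only [Finset.prod_cons]
        exact ih.mul ((T i).2.1.memLp_top (f i.succ))
    exact aux Finset.univ
  exact (MemLp.mul (r := ∞) h (Lp.memLp (f 0))).mono_exponent le_top

/-- The element `f₀ · T₁ f₁ · … · T_j f_j` of `L²(X)`, for `f₀, …, f_j ∈ L^∞(X)`; the operators
`T₁, …, T_j` are indexed by `Fin j`. -/
noncomputable def multipleProduct {P : Measure X} [IsProbabilityMeasure P] {j : ℕ}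
    (T : Fin j → koopmanGroup P) (f : Fin (j + 1) → Lp ℂ ∞ P) : Lp ℂ 2 P :=
  (memLp_multipleProduct T f).toLp _

/-- (Haar) measurability of an operator-valued map `g`, with respect to the strong operator
topology: for every `f ∈ L²(X)` the maps `m ↦ g(m) f` and `m ↦ g(m)⁻¹ f` coincide, almost everywhere
on each compact set, with a limit of simple functions. The inverse has to be mentioned only because
`L²(X)` may be nonseparable; on unitary operators the strong operator topology is also the coarsest
one that makes all the maps `T ↦ T f` and `T ↦ T⁻¹ f` continuous. -/
def IsMeasurableMap {Γ : Type*} [TopologicalSpace Γ] [MeasurableSpace Γ] (μ : Measure Γ)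
    {P : Measure X} [IsProbabilityMeasure P] (g : Γ → koopmanGroup P) : Prop :=
  ∀ K : Set Γ, IsCompact K → ∀ f : Lp ℂ 2 P,
    AEStronglyMeasurable (fun m => (g m).1 f) (μ.restrict K) ∧
    AEStronglyMeasurable (fun m => (g m).1⁻¹ f) (μ.restrict K)

end Koopman

/-!
The proof is a quantitative induction on the complexity of the system of maps `1, g₁, …, g_j`.

*Complexity.* The polynomial maps `Γ → G` form a group, filtered by the groups `polySubgroup hF s`,
in which `g ↦ g⁻¹ * twoSided a b g` leads one step down. A system is a finite set `S` of such maps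
that contains `1`. Removing some `g ≠ 1` and adding the maps `m ↦ g(m) g(amb)⁻¹ h(amb)` for the
other members `h` gives a reduced system. If `g` is chosen well, then the numbers of cosets of
`polySubgroup hF (r + 1)` that `S` hits in the coset `g * polySubgroup hF r`, for `r = 0, 1, …`,
decrease lexicographically; as reductions at most double the size of the system, the number of
reductions after which only `1` is left is bounded uniformly in `a` and `b`
(`exists_complexityLE`).

*Structure and randomness.* Fix `g ∈ S`. The correlation of an average over `aΦ` along `S` with a
bounded function `c`, as a function of `f_g`, is the inner product of `f_g` with an average `σ` over
`n ∈ Φ` of the functions `g(an)⁻¹(c ∏ conj (h(an) f_h))` (`inner_slotAverage`). So if the average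
over `aΦ`, with `u` in the place of `f_g`, has a large correlation with some `c`, then `u` has the
same correlation with the structured function `σ`. On the other hand, when `σ` is put in the place
of `f_g` and the average is taken over a set `Ψ` under which `Φ` is almost invariant, `n` can be
replaced by `mn` with `m ∈ Ψ`, and an average over `n ∈ Φ` of averages over `Ψ` along reduced
systems comes out (`norm_slotAverage_structured_sub_le`).

*Jumps.* Consider pairs of translates `aΦ`, such that each `Φ` is almost invariant under all the
sets in earlier pairs, and the distances of the two averages in each pair, the jumps. The claim is
that the first `K` jumps are at most `ε` on average, where `K` depends on `ε` and on the complexity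
alone (`hasAverageBound`). Such a bound passes to averages over `n ∈ Φ` of averages along
different systems, which a bare statement of convergence would not do. If all the jumps were large,
then structured functions could be split off from `f_g` one after the other, each at a pair in an
earlier block than the preceding one: what has been split off has small jumps on average in that
block, by induction, so the jumps must come from the remainder, which is therefore correlated with
a structured function at some pair in this block. As every step removes a fixed amount of energy,
this comes to an end (`HasAverageBound.hasJumpBound_succ`).

*Conclusion.* If the averages along two Følner nets did not approach each other, a sequence of
pairs with large jumps could be selected from them (`exists_forall_norm_systemAverage_sub_le`).
With one net this gives the Cauchy property, with two nets the independence of the limit.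

Since `Γ` need not be second countable, multiplication may fail to be measurable for the product
`σ`-algebra; the measurability of `(m, n) ↦ F(mn)` on products of compact sets, which is needed for
Fubini's theorem, follows from the completion regularity of Haar measure (`ae_prod_mul`).
-/

/-! ### Polynomial maps form a group -/

section PolynomialGroup

open scoped commutatorElement

variable {Γ N : Type*} [Group Γ] [Group N]

/-- The two-sided translate `m ↦ g(amb)` of a map `g`. -/
def twoSided (a b : Γ) (g : Γ → N) : Γ → N := fun m => g (a * m * b)

theorem twoSided_mul (a b : Γ) (g h : Γ → N) :
    twoSided a b (g * h) = twoSided a b g * twoSided a b h := rfl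

theorem twoSided_inv (a b : Γ) (g : Γ → N) :
    twoSided a b g⁻¹ = (twoSided a b g)⁻¹ := rfl

/-- The maps `g` with values in `F s` whose first `n` derivatives behave like those of a polynomial
map with respect to the shifted sequence `F s ≥ F (s + 1) ≥ …`. In contrast to `IsPolynomial`, no
derivative has to vanish, and this is what allows an induction on `n`, for all `s` at once, in the
proof that these sets are groups. -/
def polyUpTo (F : ℕ → Subgroup N) : ℕ → ℕ → Set (Γ → N)
  | 0, s => {g | ∀ m, g m ∈ F s}
  | n + 1, s => {g | (∀ m, g m ∈ F s) ∧
      ∀ a b : Γ, g⁻¹ * twoSided a b g ∈ polyUpTo F n (s + 1)}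

theorem polyUpTo_succ_subset (F : ℕ → Subgroup N) (n s : ℕ) :
    (polyUpTo F (n + 1) s : Set (Γ → N)) ⊆ polyUpTo F n s := by
  induction n generalizing s with
  | zero => exact fun g hg => hg.1
  | succ n ih => exact fun g hg => ⟨hg.1, fun a b => ih _ (hg.2 a b)⟩

theorem polyUpTo_antitone {F : ℕ → Subgroup N} (hF : Antitone F) (n s : ℕ) :
    (polyUpTo F n (s + 1) : Set (Γ → N)) ⊆ polyUpTo F n s := by
  induction n generalizing s with
  | zero => exact fun g hg m => hF (Nat.le_succ s) (hg m)
  | succ n ih =>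
    exact fun g hg => ⟨fun m => hF (Nat.le_succ s) (hg.1 m), fun a b => ih _ (hg.2 a b)⟩

theorem polyUpTo_antitone' {F : ℕ → Subgroup N} (hF : Antitone F) (n : ℕ) :
    Antitone (fun s => (polyUpTo F n s : Set (Γ → N))) :=
  antitone_nat_of_succ_le fun s => polyUpTo_antitone hF n s

/-- The maps in `polyUpTo F n s` form groups, and these satisfy the same commutator relations as
the filtration `F`. Both statements are needed for the inductive step. -/
theorem polyUpTo_group {F : ℕ → Subgroup N} (hF : Antitone F)
    (hc : ∀ i j, ⁅F i, F j⁆ ≤ F (i + j)) (n : ℕ) :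
    (∀ s, (1 : Γ → N) ∈ polyUpTo F n s) ∧
    (∀ s, ∀ g ∈ polyUpTo (Γ := Γ) F n s, g⁻¹ ∈ polyUpTo F n s) ∧
    (∀ s, ∀ g ∈ polyUpTo (Γ := Γ) F n s, ∀ h ∈ polyUpTo (Γ := Γ) F n s, g * h ∈ polyUpTo F n s) ∧
    (∀ s t, ∀ g ∈ polyUpTo (Γ := Γ) F n s, ∀ h ∈ polyUpTo (Γ := Γ) F n t,
      ⁅g, h⁆ ∈ polyUpTo F n (s + t)) := by
  induction n with
  | zero =>
    refine ⟨fun s m => one_mem _, fun s g hg m => inv_mem (hg m),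
      fun s g hg h hh m => mul_mem (hg m) (hh m), fun s t g hg h hh m => ?_⟩
    exact hc s t (Subgroup.commutator_mem_commutator (hg m) (hh m))
  | succ n ih =>
    obtain ⟨h1, hi, hm, hcomm⟩ := ih
    have anti := polyUpTo_antitone' (Γ := Γ) hF n
    have sub := fun s => polyUpTo_succ_subset (Γ := Γ) F n s
    -- The group `polyUpTo F n t` is normalized by `polyUpTo F n s`.
    have conj : ∀ s t, ∀ p ∈ polyUpTo (Γ := Γ) F n s, ∀ q ∈ polyUpTo (Γ := Γ) F n t,
        p * q * p⁻¹ ∈ polyUpTo F n t := by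
      intro s t p hp q hq
      have e : p * q * p⁻¹ = ⁅p, q⁆ * q := by rw [commutatorElement_def]; group
      rw [e]
      exact hm _ _ (anti (Nat.le_add_left t s) (hcomm _ _ _ hp _ hq)) _ hq
    have conj' : ∀ s t, ∀ p ∈ polyUpTo (Γ := Γ) F n s, ∀ q ∈ polyUpTo (Γ := Γ) F n t,
        p⁻¹ * q * p ∈ polyUpTo F n t := by
      intro s t p hp q hq
      simpa using conj s t _ (hi _ _ hp) q hq
    refine ⟨fun s => ⟨fun m => one_mem _, fun a b => ?_⟩,
      fun s g hg => ⟨fun m => inv_mem (hg.1 m), fun a b => ?_⟩,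
      fun s g hg h hh => ⟨fun m => mul_mem (hg.1 m) (hh.1 m), fun a b => ?_⟩,
      fun s t g hg h hh => ⟨fun m =>
        hc s t (Subgroup.commutator_mem_commutator (hg.1 m) (hh.1 m)), fun a b => ?_⟩⟩
    · have : (1 : Γ → N)⁻¹ * twoSided a b 1 = 1 := by
        funext m; simp [twoSided]
      rw [this]; exact h1 _
    · have e : g⁻¹⁻¹ * twoSided a b g⁻¹ = g * (g⁻¹ * twoSided a b g)⁻¹ * g⁻¹ := by
        rw [twoSided_inv]; group
      rw [e]
      exact conj s _ g (sub s hg) _ (hi _ _ (hg.2 a b))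
    · have e : (g * h)⁻¹ * twoSided a b (g * h)
          = (h⁻¹ * (g⁻¹ * twoSided a b g) * h) * (h⁻¹ * twoSided a b h) := by
        rw [twoSided_mul]; group
      rw [e]
      exact hm _ _ (conj' s _ h (sub s hh) _ (hg.2 a b)) _ (hh.2 a b)
    · set x := g⁻¹ * twoSided a b g with hx
      set y := h⁻¹ * twoSided a b h with hy
      have e : ⁅g, h⁆⁻¹ * twoSided a b ⁅g, h⁆
          = (⁅g, h⁆⁻¹ * (g * ⁅x, h * y⁆ * g⁻¹) * ⁅g, h⁆) * (h * ⁅g, y⁆ * h⁻¹) := by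
        have : twoSided a b ⁅g, h⁆ = ⁅twoSided a b g, twoSided a b h⁆ := rfl
        rw [this, hx, hy]
        simp only [commutatorElement_def]
        group
      rw [e]
      have hg' := sub s hg
      have hh' := sub t hh
      have hx' : x ∈ polyUpTo F n (s + 1) := hg.2 a b
      have hy' : y ∈ polyUpTo F n (t + 1) := hh.2 a b
      have k1 : ⁅x, h * y⁆ ∈ polyUpTo F n (s + t + 1) := by
        have := hcomm (s + 1) t x hx' _ (hm _ _ hh' _ (anti (Nat.le_succ t) hy'))
        rwa [add_right_comm] at this
      have k2 : ⁅g, y⁆ ∈ polyUpTo F n (s + t + 1) := hcomm s (t + 1) g hg' y hy'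
      exact hm _ _ (conj' (s + t) _ _ (hcomm s t g hg' h hh') _ (conj s _ g hg' _ k1)) _
        (conj t _ h hh' _ k2)

/-- The group of maps that are polynomial with respect to the sequence
`F s ≥ F (s + 1) ≥ …`. -/
def polySubgroup {F : ℕ → Subgroup N} (hF : IsGroupFiltration F) (s : ℕ) : Subgroup (Γ → N) where
  carrier := {g | ∀ n, g ∈ polyUpTo F n s}
  one_mem' n := (polyUpTo_group hF.antitone hF.commutator_le n).1 s
  inv_mem' hg n := (polyUpTo_group hF.antitone hF.commutator_le n).2.1 s _ (hg n)
  mul_mem' hg hh n := (polyUpTo_group hF.antitone hF.commutator_le n).2.2.1 s _ (hg n) _ (hh n)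

variable {F : ℕ → Subgroup N} (hF : IsGroupFiltration F)

theorem polySubgroup_antitone : Antitone (polySubgroup (Γ := Γ) hF) :=
  antitone_nat_of_succ_le fun s _ hg n => polyUpTo_antitone hF.antitone n s (hg n)

theorem derivative_mem_polySubgroup {s : ℕ} {g : Γ → N} (hg : g ∈ polySubgroup hF s) (a b : Γ) :
    g⁻¹ * twoSided a b g ∈ polySubgroup hF (s + 1) :=
  fun n => (hg (n + 1)).2 a b

theorem polySubgroup_eq_bot {s : ℕ} (hs : F s = ⊥) : polySubgroup (Γ := Γ) hF s = ⊥ := by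
  refine (Subgroup.eq_bot_iff_forall _).2 fun g hg => funext fun m => ?_
  have := hg 0 m
  rwa [hs, Subgroup.mem_bot] at this

theorem IsPolynomial.mem_polySubgroup {k s : ℕ} {g : Γ → N}
    (hg : IsPolynomial k (fun i => F (i + s)) g) : g ∈ polySubgroup hF s := by
  induction k generalizing s g with
  | zero =>
    have : g = 1 := funext hg
    rw [this]; exact one_mem _
  | succ k ih =>
    have h0 : ∀ m, g m ∈ F s := by simpa using hg.1
    intro n
    cases n with
    | zero => exact h0
    | succ n =>
      refine ⟨h0, fun a b => ih (s := s + 1) (g := g⁻¹ * twoSided a b g) ?_ n⟩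
      have := hg.2 a b
      simp only [add_assoc, add_comm 1 s] at this
      exact this

end PolynomialGroup

/-! ### Complexity of systems of polynomial maps -/

section Complexity

open scoped Classical in
theorem exists_and_not_succ {p : ℕ → Prop} {D : ℕ} (h0 : p 0) (hD : ¬ p D) :
    ∃ s < D, p s ∧ ¬ p (s + 1) := by
  have hex : ∃ n, ¬ p n := ⟨D, hD⟩
  have hne : Nat.find hex ≠ 0 := fun h => Nat.find_spec hex (h ▸ h0)
  obtain ⟨s, hs⟩ := Nat.exists_eq_succ_of_ne_zero hne
  refine ⟨s, ?_, ?_, ?_⟩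
  · have := Nat.find_min' hex hD
    omega
  · exact not_not.1 (Nat.find_min hex (by omega : s < Nat.find hex))
  · have := Nat.find_spec hex
    rwa [hs] at this

theorem toLex_lt_of_le_of_lt {D : ℕ} {a b : Fin D → ℕ} (i : Fin D) (hle : ∀ j < i, a j ≤ b j)
    (hlt : a i < b i) : toLex a < toLex b := by
  classical
  have hex : ∃ n, ∃ h : n < D, a ⟨n, h⟩ < b ⟨n, h⟩ := ⟨i, i.2, hlt⟩
  obtain ⟨hn, hfind⟩ := Nat.find_spec hex
  refine ⟨⟨Nat.find hex, hn⟩, fun j hj => ?_, hfind⟩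
  have hji : j < i := lt_of_lt_of_le hj (Fin.le_def.2 (Nat.find_min' hex ⟨i.2, hlt⟩))
  refine le_antisymm (hle j hji) (not_lt.1 fun hcon => ?_)
  exact Nat.find_min hex (Fin.lt_def.1 hj) ⟨j.2, hcon⟩

variable {Γ N : Type*} [Group N]

variable {Q : ℕ → Subgroup (Γ → N)} (hQ : Antitone Q)

open scoped Classical in
/-- The number of cosets of `Q (r + 1)` in the coset `g Q r` that are hit by `S`. -/
noncomputable def cosetCount (Q : ℕ → Subgroup (Γ → N)) (S : Finset (Γ → N)) (g : Γ → N)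
    (r : ℕ) : ℕ :=
  ((S.filter (fun h => g⁻¹ * h ∈ Q r)).image
    (fun h => (QuotientGroup.mk h : (Γ → N) ⧸ Q (r + 1)))).card

open scoped Classical in
theorem cosetCount_le (S : Finset (Γ → N)) (g : Γ → N) (r : ℕ) : cosetCount Q S g r ≤ S.card :=
  Finset.card_image_le.trans (Finset.card_filter_le _ _)

/-- The member `g` is a legitimate choice for a reduction: when `g` and `1` lie in the same coset of
`Q (r + 1)`, then this is the only coset of `Q (r + 1)` in `Q r` that is hit by `S`. Choosing `g` in
this way makes sure that the coset counts really decrease, although `1` is never removed. -/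
def IsAdmissible (Q : ℕ → Subgroup (Γ → N)) (S : Finset (Γ → N)) (g : Γ → N) : Prop :=
  ∀ r, g ∈ Q (r + 1) → ∀ h ∈ S, g⁻¹ * h ∈ Q r → h ∈ Q (r + 1)

include hQ in
open scoped Classical in
/-- In the coset of `g` at level `s`, a member `x ≠ 1` of `S` that leaves the chain `Q` as early as
possible: whenever `x` lies in `Q (r + 1)`, then so does the whole part of `S` in this coset. -/
theorem exists_earliest_branch {D : ℕ} (hD : Q D = ⊥) {S : Finset (Γ → N)} {g : Γ → N} {s : ℕ}
    (hne : ∃ x ∈ S, x ≠ 1 ∧ g⁻¹ * x ∈ Q s) :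
    ∃ x ∈ S, x ≠ 1 ∧ g⁻¹ * x ∈ Q s ∧
      ∀ r, x ∈ Q (r + 1) → ∀ h ∈ S, g⁻¹ * h ∈ Q s → h ∈ Q (r + 1) := by
  have hex : ∀ x : Γ → N, x ≠ 1 → ∃ r, x ∉ Q r := fun x hx =>
    ⟨D, fun h => hx (by rwa [hD, Subgroup.mem_bot] at h)⟩
  obtain ⟨x₀, hx₀, hx₀1, hx₀s⟩ := hne
  let T := S.filter (fun x => x ≠ 1 ∧ g⁻¹ * x ∈ Q s)
  let ℓ : (Γ → N) → ℕ := fun x => if hx : ∃ r, x ∉ Q r then Nat.find hx else 0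
  obtain ⟨x, hxT, hmin⟩ := T.exists_min_image ℓ ⟨x₀, Finset.mem_filter.2 ⟨hx₀, hx₀1, hx₀s⟩⟩
  obtain ⟨hxS, hx1, hxs⟩ := Finset.mem_filter.1 hxT
  refine ⟨x, hxS, hx1, hxs, fun r hxr h hhS hhs => ?_⟩
  by_cases hh1 : h = 1
  · rw [hh1]; exact one_mem _
  have hle := hmin h (Finset.mem_filter.2 ⟨hhS, hh1, hhs⟩)
  simp only [ℓ, dif_pos (hex x hx1), dif_pos (hex h hh1)] at hle
  have hlt : r + 1 < Nat.find (hex x hx1) := by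
    by_contra hcon
    exact Nat.find_spec (hex x hx1) (hQ (not_lt.1 hcon) hxr)
  exact not_not.1 (Nat.find_min (hex h hh1) (hlt.trans_le hle))

variable [Group Γ]

/-- The map `m ↦ g(m) g(amb)⁻¹ h(amb)`. -/
def reduct (g h : Γ → N) (a b : Γ) : Γ → N := fun m => g m * (g (a * m * b))⁻¹ * h (a * m * b)

theorem reduct_eq (g h : Γ → N) (a b : Γ) : reduct g h a b = g * twoSided a b (g⁻¹ * h) := by
  funext m
  simp [reduct, twoSided, mul_assoc]

open scoped Classical in
/-- A system is a finite set of maps that contains the constant map `1`. Reducing it with respect to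
one of its members `g ≠ 1` removes `g` and adds the maps `m ↦ g(m) g(amb)⁻¹ h(amb)` for all the
other members `h`. -/
noncomputable def reducedSystem (S : Finset (Γ → N)) (g : Γ → N) (a b : Γ) : Finset (Γ → N) :=
  S.erase g ∪ (S.erase g).image (fun h => reduct g h a b)

/-- The system `S` becomes trivial after at most `n` reductions, no matter which translations are
used in these. -/
def ComplexityLE : ℕ → Finset (Γ → N) → Prop
  | 0, S => S ⊆ {1}
  | n + 1, S => S ⊆ {1} ∨ ∃ g ∈ S, g ≠ 1 ∧ ∀ a b : Γ, ComplexityLE n (reducedSystem S g a b)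

theorem ComplexityLE.of_subset {S : Finset (Γ → N)} (h : S ⊆ {1}) (n : ℕ) : ComplexityLE n S := by
  cases n with
  | zero => exact h
  | succ n => exact Or.inl h

theorem ComplexityLE.mono {S : Finset (Γ → N)} {n k : ℕ} (hnk : n ≤ k) (h : ComplexityLE n S) :
    ComplexityLE k S := by
  induction n generalizing S k with
  | zero => exact .of_subset h k
  | succ n ih =>
    obtain ⟨k, rfl⟩ : ∃ k', k = k' + 1 := ⟨k - 1, by omega⟩
    rcases h with h | ⟨g, hg, hg1, h⟩
    · exact Or.inl h
    · exact Or.inr ⟨g, hg, hg1, fun a b => ih (by omega) (h a b)⟩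

theorem one_mem_reducedSystem {S : Finset (Γ → N)} {g : Γ → N} (h1 : 1 ∈ S) (hg : g ≠ 1)
    (a b : Γ) : 1 ∈ reducedSystem S g a b := by
  classical
  exact Finset.mem_union_left _ (Finset.mem_erase.2 ⟨hg.symm, h1⟩)

theorem card_reducedSystem_le (S : Finset (Γ → N)) (g : Γ → N) (a b : Γ) :
    (reducedSystem S g a b).card ≤ 2 * S.card := by
  classical
  have h1 : (S.erase g).card ≤ S.card := Finset.card_le_card (Finset.erase_subset _ _)
  have h2 := (Finset.card_image_le (s := S.erase g) (f := fun h => reduct g h a b))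
  have h3 := Finset.card_union_le (S.erase g) ((S.erase g).image (fun h => reduct g h a b))
  unfold reducedSystem
  omega

variable (hd : ∀ s, ∀ r ∈ Q s, ∀ a b : Γ, r⁻¹ * twoSided a b r ∈ Q (s + 1))

include hQ hd in
theorem twoSided_mem_iff {s : ℕ} {r : Γ → N} (a b : Γ) : twoSided a b r ∈ Q s ↔ r ∈ Q s := by
  have key : ∀ (a b : Γ) (r : Γ → N), r ∈ Q s → twoSided a b r ∈ Q s := fun a b r hr => by
    have := mul_mem hr (hQ (Nat.le_succ s) (hd s r hr a b))
    rwa [mul_inv_cancel_left] at this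
  refine ⟨fun h => ?_, key a b r⟩
  have h' := key a⁻¹ b⁻¹ _ h
  have e : twoSided a⁻¹ b⁻¹ (twoSided a b r) = r := by
    funext m
    simp [twoSided, mul_assoc]
  rwa [e] at h'

include hQ hd in
/-- A member of the reduced system comes from a member `h ≠ g` of the original system, from which it
differs by less than `h` differs from `g`. -/
theorem exists_of_mem_reducedSystem {S : Finset (Γ → N)} {g : Γ → N} {a b : Γ} {k : Γ → N}
    (hk : k ∈ reducedSystem S g a b) :
    ∃ h ∈ S, h ≠ g ∧ ∀ r, (g⁻¹ * k ∈ Q r → g⁻¹ * h ∈ Q r) ∧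
      (g⁻¹ * h ∈ Q r → h⁻¹ * k ∈ Q (r + 1)) := by
  classical
  rcases Finset.mem_union.1 hk with hk | hk
  · refine ⟨k, Finset.mem_of_mem_erase hk, Finset.ne_of_mem_erase hk, fun r => ⟨id, fun _ => ?_⟩⟩
    rw [inv_mul_cancel]; exact one_mem _
  · obtain ⟨h, hh, rfl⟩ := Finset.mem_image.1 hk
    refine ⟨h, Finset.mem_of_mem_erase hh, Finset.ne_of_mem_erase hh, fun r => ⟨fun h1 => ?_,
      fun h1 => ?_⟩⟩
    · rw [reduct_eq, inv_mul_cancel_left] at h1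
      exact (twoSided_mem_iff hQ hd a b).1 h1
    · have := hd r _ h1 a b
      rwa [mul_inv_rev, inv_inv, mul_assoc, ← reduct_eq] at this

include hQ hd in
open scoped Classical in
/-- The reduction with respect to an admissible `g` leaves a system with another admissible member
and with smaller coset counts, in the lexicographic order. -/
theorem exists_admissible_reducedSystem {D : ℕ} (hD : Q D = ⊥) {S : Finset (Γ → N)} {g : Γ → N}
    (hS : ∀ h ∈ S, h ∈ Q 0) (hgS : g ∈ S) (hadm : IsAdmissible Q S g) (a b : Γ)
    (hne : ¬ reducedSystem S g a b ⊆ {1}) :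
    ∃ g' ∈ reducedSystem S g a b, g' ≠ 1 ∧ IsAdmissible Q (reducedSystem S g a b) g' ∧
      toLex (fun r : Fin D => cosetCount Q (reducedSystem S g a b) g' r) <
        toLex (fun r : Fin D => cosetCount Q S g r) := by
  set S' := reducedSystem S g a b with hS'
  have key := fun k (hk : k ∈ S') => exists_of_mem_reducedSystem hQ hd hk
  have mem0 : ∀ k ∈ S', g⁻¹ * k ∈ Q 0 := fun k hk => by
    obtain ⟨h, hh, -, hr⟩ := key k hk
    have h1 : g⁻¹ * h ∈ Q 0 := mul_mem (inv_mem (hS g hgS)) (hS h hh)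
    have := mul_mem h1 (hQ (Nat.le_succ 0) ((hr 0).2 h1))
    rwa [mul_assoc, mul_inv_cancel_left] at this
  -- `s` is the last level at which the coset of `g` still has a nontrivial member.
  obtain ⟨s, hsD, hs, hs'⟩ : ∃ s < D, (∃ x ∈ S', x ≠ 1 ∧ g⁻¹ * x ∈ Q s) ∧
      ¬ ∃ x ∈ S', x ≠ 1 ∧ g⁻¹ * x ∈ Q (s + 1) := by
    refine exists_and_not_succ (p := fun s => ∃ x ∈ S', x ≠ 1 ∧ g⁻¹ * x ∈ Q s) ?_ ?_
    · by_contra hcon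
      push Not at hcon
      refine hne fun x hx => Finset.mem_singleton.2 ?_
      by_contra hx1
      exact hcon x hx hx1 (mem0 x hx)
    · rintro ⟨x, hx, -, hxD⟩
      obtain ⟨h, -, hhg, hr⟩ := key x hx
      have := (hr D).1 hxD
      rw [hD, Subgroup.mem_bot] at this
      exact hhg (inv_mul_eq_one.1 this).symm
  obtain ⟨g', hg'S, hg'1, hg's, hbr⟩ := exists_earliest_branch hQ hD hs
  -- Up to level `s`, the cosets of `g` and `g'` agree.
  have same : ∀ r ≤ s, ∀ k, g'⁻¹ * k ∈ Q r ↔ g⁻¹ * k ∈ Q r := by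
    intro r hr k
    have hgg : g⁻¹ * g' ∈ Q r := hQ hr hg's
    constructor
    · intro h
      have := mul_mem hgg h
      rwa [mul_assoc, mul_inv_cancel_left] at this
    · intro h
      have := mul_mem (inv_mem hgg) h
      rwa [mul_inv_rev, inv_inv, mul_assoc, mul_inv_cancel_left] at this
  have trapped : ∀ r, g ∈ Q (r + 1) → ∀ k ∈ S', g⁻¹ * k ∈ Q r → k ∈ Q (r + 1) := by
    intro r hgr k hk hkr
    obtain ⟨h, hh, -, hr⟩ := key k hk
    have h1 := (hr r).1 hkr
    have := mul_mem (hadm r hgr h hh h1) ((hr r).2 h1)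
    rwa [mul_inv_cancel_left] at this
  refine ⟨g', hg'S, hg'1, ?_, ?_⟩
  · intro r hg'r k hk hkr
    rcases le_or_gt s r with hsr | hrs
    · refine hbr r hg'r k hk ?_
      exact (same s le_rfl k).1 (hQ hsr hkr)
    · refine trapped r ?_ k hk ((same r hrs.le k).1 hkr)
      have := mul_mem hg'r (inv_mem (hQ hrs hg's))
      rwa [mul_inv_rev, inv_inv, mul_inv_cancel_left] at this
  · have sub : ∀ r ≤ s, (S'.filter (fun h => g'⁻¹ * h ∈ Q r)).image
          (fun h => (QuotientGroup.mk h : (Γ → N) ⧸ Q (r + 1))) ⊆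
        (S.filter (fun h => g⁻¹ * h ∈ Q r)).image
          (fun h => (QuotientGroup.mk h : (Γ → N) ⧸ Q (r + 1))) := by
      intro r hr q hq
      obtain ⟨k, hk, rfl⟩ := Finset.mem_image.1 hq
      obtain ⟨hkS, hkr⟩ := Finset.mem_filter.1 hk
      obtain ⟨h, hh, -, hr'⟩ := key k hkS
      have h1 := (hr' r).1 ((same r hr k).1 hkr)
      exact Finset.mem_image.2 ⟨h, Finset.mem_filter.2 ⟨hh, h1⟩,
        QuotientGroup.eq.2 ((hr' r).2 h1)⟩
    refine toLex_lt_of_le_of_lt ⟨s, hsD⟩ (fun r hr => Finset.card_le_card (sub r ?_)) ?_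
    · exact (Fin.lt_def.1 hr).le
    · refine Finset.card_lt_card ⟨sub s le_rfl, fun hcon => ?_⟩
      have hgm : (QuotientGroup.mk g : (Γ → N) ⧸ Q (s + 1)) ∈
          (S.filter (fun h => g⁻¹ * h ∈ Q s)).image
          (fun h => (QuotientGroup.mk h : (Γ → N) ⧸ Q (s + 1))) := by
        refine Finset.mem_image.2 ⟨g, Finset.mem_filter.2 ⟨hgS, ?_⟩, rfl⟩
        rw [inv_mul_cancel]; exact one_mem _
      obtain ⟨k, hk, hkg⟩ := Finset.mem_image.1 (hcon hgm)
      have hkS := (Finset.mem_filter.1 hk).1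
      have hgk : g⁻¹ * k ∈ Q (s + 1) := QuotientGroup.eq.1 hkg.symm
      have hk1 : k = 1 := by
        by_contra hk1
        exact hs' ⟨k, hkS, hk1, hgk⟩
      rw [hk1, mul_one, inv_mem_iff] at hgk
      exact hs' ⟨g', hg'S, hg'1, mul_mem (inv_mem hgk) (trapped s hgk g' hg'S hg's)⟩

theorem reducedSystem_mem {S : Finset (Γ → N)} {g : Γ → N} {P : Subgroup (Γ → N)}
    (hP : ∀ r ∈ P, ∀ a b : Γ, twoSided a b r ∈ P)
    (hS : ∀ h ∈ S, h ∈ P) (hg : g ∈ S) (a b : Γ) : ∀ h ∈ reducedSystem S g a b, h ∈ P := by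
  classical
  intro k hk
  rcases Finset.mem_union.1 hk with hk | hk
  · exact hS k (Finset.mem_of_mem_erase hk)
  · obtain ⟨h, hh, rfl⟩ := Finset.mem_image.1 hk
    rw [reduct_eq]
    exact mul_mem (hS g hg) (hP _ (mul_mem (inv_mem (hS g hg))
      (hS h (Finset.mem_of_mem_erase hh))) a b)

include hQ hd in
open scoped Classical in
/-- The complexity is bounded in terms of the coset counts and the size of the system. Since a
reduction at most doubles the size, it leads to one of finitely many vectors of smaller coset
counts, and the bound is uniform in the translations. -/
theorem exists_complexityLE_of_admissible {D : ℕ} (hD : Q D = ⊥) (c : Lex (Fin D → ℕ)) (M : ℕ) :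
    ∃ n, ∀ S : Finset (Γ → N), 1 ∈ S → (∀ h ∈ S, h ∈ Q 0) → S.card ≤ M → ∀ g ∈ S, g ≠ 1 →
      IsAdmissible Q S g → toLex (fun r : Fin D => cosetCount Q S g r) = c →
      ComplexityLE n S := by
  induction c using WellFoundedLT.induction generalizing M with
  | ind c ih =>
    choose n hn using ih
    let C : Finset (Fin D → ℕ) := Fintype.piFinset (fun _ => Finset.range (2 * M + 1))
    let n' : (Fin D → ℕ) → ℕ := fun c' => if h : toLex c' < c then n (toLex c') h (2 * M) else 0
    refine ⟨C.sup n' + 1, fun S h1 hS hM g hg hg1 hadm hc => Or.inr ⟨g, hg, hg1, fun a b => ?_⟩⟩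
    by_cases hne : reducedSystem S g a b ⊆ {1}
    · exact .of_subset hne _
    obtain ⟨g', hg', hg'1, hadm', hlt⟩ :=
      exists_admissible_reducedSystem hQ hd hD hS hg hadm a b hne
    rw [hc] at hlt
    have hcard : (reducedSystem S g a b).card ≤ 2 * M :=
      (card_reducedSystem_le S g a b).trans (by omega)
    have hfin := hn _ hlt (2 * M) _ (one_mem_reducedSystem h1 hg1 a b)
      (reducedSystem_mem (fun r hr a b => (twoSided_mem_iff hQ hd a b).2 hr) hS hg a b) hcard g'
      hg' hg'1 hadm' rfl
    refine hfin.mono ?_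
    have hmem : (fun r : Fin D => cosetCount Q (reducedSystem S g a b) g' r) ∈ C :=
      Fintype.mem_piFinset.2 fun r => Finset.mem_range.2
        (Nat.lt_succ_of_le ((cosetCount_le _ _ _).trans hcard))
    have := Finset.le_sup (f := n') hmem
    simpa only [n', dif_pos hlt] using this

include hQ hd in
/-- Every system of polynomial maps has finite complexity. -/
theorem exists_complexityLE {D : ℕ} (hD : Q D = ⊥) {S : Finset (Γ → N)} (h1 : 1 ∈ S)
    (hS : ∀ h ∈ S, h ∈ Q 0) : ∃ n, ComplexityLE n S := by
  by_cases hne : S ⊆ {1}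
  · exact ⟨0, hne⟩
  have hne' : ∃ x ∈ S, x ≠ 1 ∧ (1 : Γ → N)⁻¹ * x ∈ Q 0 := by
    by_contra hcon
    push Not at hcon
    refine hne fun x hx => Finset.mem_singleton.2 ?_
    by_contra hx1
    exact hcon x hx hx1 (by simpa using hS x hx)
  obtain ⟨g, hg, hg1, -, hbr⟩ := exists_earliest_branch hQ hD hne'
  have hadm : IsAdmissible Q S g := fun r hgr h hh _ => hbr r hgr h hh (by simpa using hS h hh)
  obtain ⟨n, hn⟩ := exists_complexityLE_of_admissible hQ hd hD
    (toLex (fun r : Fin D => cosetCount Q S g r)) S.card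
  exact ⟨n, hn S h1 hS le_rfl g hg hg1 hadm rfl⟩

end Complexity

/-! ### The unit ball of bounded functions -/

section UnitBall

open scoped ComplexConjugate InnerProductSpace

variable {X : Type*} [MeasurableSpace X]

/-- The functions on `X` that are bounded by `1` almost everywhere, as a monoid under pointwise
multiplication. -/
def unitBall (P : Measure X) : Submonoid (X →ₘ[P] ℂ) where
  carrier := {f | ∀ᵐ x ∂P, ‖f x‖ ≤ 1}
  one_mem' := by
    filter_upwards [AEEqFun.coeFn_one (μ := P) (β := ℂ)] with x hx
    simp [hx]
  mul_mem' {f g} hf hg := by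
    filter_upwards [hf, hg, AEEqFun.coeFn_mul f g] with x h1 h2 h3
    rw [h3, Pi.mul_apply, norm_mul]
    exact mul_le_one₀ h1 (norm_nonneg _) h2

variable {P : Measure X}

theorem unitBall_norm_le (b : unitBall P) : ∀ᵐ x ∂P, ‖b.1 x‖ ≤ 1 := b.2

noncomputable instance : Star (unitBall P) where
  star b := ⟨star b.1, by
    filter_upwards [unitBall_norm_le b, AEEqFun.coeFn_star b.1] with x h1 h2
    rw [h2, Pi.star_apply, norm_star]
    exact h1⟩

/-- Multiplication by a function bounded by `1`, as an operator on `L²`. -/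
noncomputable def mulOp (b : unitBall P) : Lp ℂ 2 P →L[ℂ] Lp ℂ 2 P :=
  LinearMap.mkContinuous
    { toFun := fun v => ⟨b.1 * v.1, Lp.mem_Lp_iff_memLp.2 <| by
        refine (Lp.memLp v).mono (b.1 * v.1).aestronglyMeasurable ?_
        filter_upwards [unitBall_norm_le b, AEEqFun.coeFn_mul b.1 v.1] with x h1 h2
        rw [h2, Pi.mul_apply, norm_mul]
        exact mul_le_of_le_one_left (norm_nonneg _) h1⟩
      map_add' := fun u v => Lp.ext <| by
        filter_upwards [AEEqFun.coeFn_mul b.1 (u + v).1, AEEqFun.coeFn_mul b.1 u.1,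
          AEEqFun.coeFn_mul b.1 v.1, Lp.coeFn_add u v,
          Lp.coeFn_add (⟨b.1 * u.1, _⟩ : Lp ℂ 2 P) ⟨b.1 * v.1, _⟩] with x h1 h2 h3 h4 h5
        refine h1.trans (Eq.trans ?_ h5.symm)
        simp only [Pi.mul_apply, Pi.add_apply] at *
        rw [h4, h2, h3, mul_add]
      map_smul' := fun c v => Lp.ext <| by
        filter_upwards [AEEqFun.coeFn_mul b.1 (c • v).1, AEEqFun.coeFn_mul b.1 v.1,
          Lp.coeFn_smul c v, Lp.coeFn_smul c (⟨b.1 * v.1, _⟩ : Lp ℂ 2 P)] with x h1 h2 h3 h4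
        refine h1.trans (Eq.trans ?_ h4.symm)
        simp only [Pi.mul_apply, Pi.smul_apply, smul_eq_mul] at *
        rw [h3, h2, mul_left_comm] }
    1 fun v => by
      rw [one_mul]
      refine Lp.norm_le_norm_of_ae_le ?_
      filter_upwards [unitBall_norm_le b, AEEqFun.coeFn_mul b.1 v.1] with x h1 h2
      refine (congrArg norm h2).le.trans ?_
      rw [Pi.mul_apply, norm_mul]
      exact mul_le_of_le_one_left (norm_nonneg _) h1

theorem coeFn_mulOp (b : unitBall P) (v : Lp ℂ 2 P) : mulOp b v =ᵐ[P] fun x => b.1 x * v x :=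
  AEEqFun.coeFn_mul b.1 v.1

theorem norm_mulOp_le (b : unitBall P) (v : Lp ℂ 2 P) : ‖mulOp b v‖ ≤ ‖v‖ := by
  refine Lp.norm_le_norm_of_ae_le ?_
  filter_upwards [unitBall_norm_le b, coeFn_mulOp b v] with x h1 h2
  rw [h2, norm_mul]
  exact mul_le_of_le_one_left (norm_nonneg _) h1

theorem coeFn_star_unitBall (b : unitBall P) : (star b).1 =ᵐ[P] fun x => conj (b.1 x) :=
  AEEqFun.coeFn_star b.1

theorem inner_mulOp (b : unitBall P) (v w : Lp ℂ 2 P) :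
    ⟪mulOp b v, w⟫_ℂ = ⟪v, mulOp (star b) w⟫_ℂ := by
  rw [L2.inner_def, L2.inner_def]
  refine integral_congr_ae ?_
  filter_upwards [coeFn_mulOp b v, coeFn_mulOp (star b) w, coeFn_star_unitBall b] with x h1 h2 h3
  simp only [h1, h2, h3, RCLike.inner_apply, map_mul]
  ring

theorem star_mul_unitBall (b c : unitBall P) : star (b * c) = star b * star c := by
  refine Subtype.ext (AEEqFun.ext ?_)
  filter_upwards [coeFn_star_unitBall (b * c), coeFn_star_unitBall b, coeFn_star_unitBall c,
    AEEqFun.coeFn_mul b.1 c.1, AEEqFun.coeFn_mul (star b).1 (star c).1] with x h1 h2 h3 h4 h5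
  refine h1.trans (Eq.trans ?_ h5.symm)
  rw [Pi.mul_apply, h2, h3, ← map_mul]
  exact congrArg conj h4

theorem star_star_unitBall (b : unitBall P) : star (star b) = b :=
  Subtype.ext (star_star b.1)

theorem star_one_unitBall : star (1 : unitBall P) = 1 := by
  have h := star_mul_unitBall (star (1 : unitBall P)) 1
  rw [mul_one, star_star_unitBall, one_mul] at h
  exact h.symm

theorem star_prod_unitBall {ι : Type*} (s : Finset ι) (f : ι → unitBall P) :
    star (∏ i ∈ s, f i) = ∏ i ∈ s, star (f i) := by
  classical
  induction s using Finset.induction with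
  | empty => simp [star_one_unitBall]
  | insert i s hi ih => rw [Finset.prod_insert hi, Finset.prod_insert hi, star_mul_unitBall, ih]

theorem isClosed_norm_le_one : IsClosed {v : Lp ℂ 2 P | ∀ᵐ x ∂P, ‖v x‖ ≤ 1} := by
  refine IsSeqClosed.isClosed fun u v hu huv => ?_
  obtain ⟨ns, -, hns⟩ := (tendstoInMeasure_of_tendsto_Lp huv).exists_seq_tendsto_ae
  have hall : ∀ᵐ x ∂P, ∀ n, ‖u n x‖ ≤ 1 := ae_all_iff.2 hu
  filter_upwards [hns, hall] with x h1 h2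
  exact le_of_tendsto h1.norm (Eventually.of_forall fun i => h2 (ns i))

theorem convex_norm_le_one : Convex ℝ {v : Lp ℂ 2 P | ∀ᵐ x ∂P, ‖v x‖ ≤ 1} := by
  intro u hu v hv s t hs ht hst
  filter_upwards [hu, hv, Lp.coeFn_add (s • u) (t • v), Lp.coeFn_smul s u, Lp.coeFn_smul t v]
    with x h1 h2 h3 h4 h5
  rw [h3, Pi.add_apply, h4, h5, Pi.smul_apply, Pi.smul_apply]
  refine (norm_add_le _ _).trans ?_
  rw [norm_smul, norm_smul, Real.norm_of_nonneg hs, Real.norm_of_nonneg ht]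
  nlinarith

variable [IsProbabilityMeasure P]

/-- The inclusion of the unit ball of bounded functions into `L²`. -/
noncomputable def toL2 (b : unitBall P) : Lp ℂ 2 P :=
  ⟨b.1, Lp.mem_Lp_iff_memLp.2
    (MemLp.of_bound b.1.aestronglyMeasurable 1 (unitBall_norm_le b))⟩

/-- The inclusion of the unit ball of bounded functions into `L^∞`. -/
noncomputable def toLinfty (b : unitBall P) : Lp ℂ ∞ P :=
  ⟨b.1, Lp.mem_Lp_iff_memLp.2
    (MemLp.of_bound b.1.aestronglyMeasurable 1 (unitBall_norm_le b))⟩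

theorem toL2_injective : Function.Injective (toL2 (P := P)) := fun _ _ h =>
  Subtype.ext (congrArg (fun v : Lp ℂ 2 P => v.1) h)

theorem norm_toL2_le (b : unitBall P) : ‖toL2 b‖ ≤ 1 := by
  have := Lp.norm_le_of_ae_bound (p := 2) (f := toL2 b) (C := 1) zero_le_one (unitBall_norm_le b)
  simpa [measureUnivNNReal] using this

theorem linftyToL2_toLinfty (b : unitBall P) : linftyToL2 (toLinfty b) = toL2 b :=
  Lp.ext (coeFn_linftyToL2 _)

theorem exists_toL2_eq {v : Lp ℂ 2 P} (hv : ∀ᵐ x ∂P, ‖v x‖ ≤ 1) : ∃ b : unitBall P, toL2 b = v :=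
  ⟨⟨v.1, hv⟩, rfl⟩

theorem mulOp_toL2 (b c : unitBall P) : mulOp b (toL2 c) = toL2 (b * c) := rfl

/-! ### The action of unitary operators on the unit ball -/

theorem norm_koopman_le_one (T : koopmanGroup P) (b : unitBall P) :
    ∀ᵐ x ∂P, ‖T.1 (toL2 b) x‖ ≤ 1 := by
  have h := T.2.1.isometric (toLinfty b)
  rw [linftyToL2_toLinfty] at h
  have h1 : eLpNorm (toLinfty b) ∞ P ≤ 1 := by
    rw [eLpNorm_exponent_top]
    refine eLpNormEssSup_le_of_ae_enorm_bound ?_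
    filter_upwards [unitBall_norm_le b] with x hx
    rw [← ofReal_norm]; exact ENNReal.ofReal_le_one.2 hx
  rw [← h, eLpNorm_exponent_top] at h1
  filter_upwards [ae_le_eLpNormEssSup (f := T.1 (toL2 b)) (μ := P)] with x hx
  have := hx.trans h1
  rw [← ofReal_norm] at this
  exact ENNReal.ofReal_le_one.1 this

noncomputable instance : SMul (koopmanGroup P) (unitBall P) where
  smul T b := ⟨(T.1 (toL2 b)).1, norm_koopman_le_one T b⟩

theorem toL2_smul (T : koopmanGroup P) (b : unitBall P) : toL2 (T • b) = T.1 (toL2 b) := rfl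

theorem koopman_smul_mul (T : koopmanGroup P) (b c : unitBall P) :
    T • (b * c) = (T • b) * (T • c) := by
  have e : linftyToL2 (toLinfty b • toLinfty c : Lp ℂ ∞ P) = toL2 (b * c) := by
    refine Lp.ext ?_
    filter_upwards [coeFn_linftyToL2 (toLinfty b • toLinfty c : Lp ℂ ∞ P),
      Lp.coeFn_lpSMul (r := ∞) (toLinfty b) (toLinfty c), AEEqFun.coeFn_mul b.1 c.1]
      with x h1 h2 h3
    rw [h1, h2]
    exact h3.symm
  have h := T.2.1.map_mul (toLinfty b) (toLinfty c)
  rw [e, linftyToL2_toLinfty, linftyToL2_toLinfty] at h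
  refine toL2_injective (Lp.ext ?_)
  filter_upwards [h, AEEqFun.coeFn_mul (T • b).1 (T • c).1] with x h1 h2
  exact h1.trans h2.symm

noncomputable instance : MulAction (koopmanGroup P) (unitBall P) where
  one_smul _ := rfl
  mul_smul _ _ _ := rfl

noncomputable instance : MulDistribMulAction (koopmanGroup P) (unitBall P) where
  smul_mul := koopman_smul_mul
  -- Since `T` is onto and multiplicative, `T 1` is a unit element.
  smul_one T := by
    have h := koopman_smul_mul T 1 (T⁻¹ • 1)
    rwa [one_mul, smul_inv_smul, mul_one, eq_comm] at h

/-- The action commutes with complex conjugation: being unitary and multiplicative, `T` preserves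
the integrals `∫ b f = ⟪star b, f⟫`. -/
theorem koopman_smul_star (T : koopmanGroup P) (b : unitBall P) : T • star b = star (T • b) := by
  have key : ∀ f : unitBall P,
      ⟪toL2 (star (T • b)), toL2 (T • f)⟫_ℂ = ⟪toL2 (T • star b), toL2 (T • f)⟫_ℂ := by
    intro f
    have h1 : ∀ c g : unitBall P, ⟪toL2 (star c), toL2 g⟫_ℂ = ⟪toL2 1, toL2 (c * g)⟫_ℂ := by
      intro c g
      rw [← mul_one (star c), ← mulOp_toL2, inner_mulOp, star_star_unitBall, mulOp_toL2]
    have h2 : ∀ c g : unitBall P, ⟪toL2 (T • c), toL2 (T • g)⟫_ℂ = ⟪toL2 c, toL2 g⟫_ℂ :=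
      fun c g => T.1.inner_map_map _ _
    rw [h1, ← smul_mul', h2, h1, ← h2 (1 : unitBall P) (b * f), smul_one]
  have key' : ∀ f : unitBall P, ⟪toL2 (star (T • b)) - toL2 (T • star b), toL2 f⟫_ℂ = 0 := by
    intro f
    have := key (T⁻¹ • f)
    rw [smul_inv_smul] at this
    rw [inner_sub_left, this, sub_self]
  refine toL2_injective (sub_eq_zero.1 ?_).symm
  rw [← inner_self_eq_zero (𝕜 := ℂ), inner_sub_right, key', key', sub_zero]

/-- Half the difference of two functions bounded by `1` lies in the unit ball. -/
theorem exists_toL2_eq_half_sub {u v : Lp ℂ 2 P} (hu : ∀ᵐ x ∂P, ‖u x‖ ≤ 1)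
    (hv : ∀ᵐ x ∂P, ‖v x‖ ≤ 1) : ∃ b : unitBall P, u - v = (2 : ℝ) • toL2 b := by
  have h := convex_norm_le_one (P := P) hu (y := -v) (by
    filter_upwards [hv, Lp.coeFn_neg v] with x h1 h2
    rw [h2, Pi.neg_apply, norm_neg]; exact h1)
    (a := 1 / 2) (b := 1 / 2) (by norm_num) (by norm_num) (by norm_num)
  obtain ⟨b, hb⟩ := exists_toL2_eq h
  refine ⟨b, ?_⟩
  rw [hb, smul_add, smul_smul, smul_smul]
  norm_num
  abel

end UnitBall

/-! ### Measurability in groups without a countable base -/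

section LocallyCompact

variable {Γ : Type*} [TopologicalSpace Γ] [T2Space Γ] [MeasurableSpace Γ] [BorelSpace Γ]
  {E : Type*} [NormedAddCommGroup E] (μ : Measure Γ)

theorem ae_mem_prod [IsFiniteMeasureOnCompacts μ] {K L : Set Γ} (hK : IsCompact K)
    (hL : IsCompact L) : ∀ᵐ z ∂(μ.restrict K).prod (μ.restrict L), z ∈ K ×ˢ L := by
  have : IsFiniteMeasure (μ.restrict K) := ⟨by simpa using hK.measure_lt_top⟩
  have : IsFiniteMeasure (μ.restrict L) := ⟨by simpa using hL.measure_lt_top⟩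
  filter_upwards [Measure.quasiMeasurePreserving_fst.ae (ae_restrict_mem hK.measurableSet),
    Measure.quasiMeasurePreserving_snd.ae (ae_restrict_mem hL.measurableSet)] with z h1 h2
  exact ⟨h1, h2⟩

/-- Density of the continuous functions in `L¹`, without normality of the space. -/
theorem exists_continuous_eLpNorm_one_sub_le [LocallyCompactSpace Γ] [μ.Regular] [NormedSpace ℝ E]
    {f : Γ → E} (hf : Integrable f μ) {ε : ℝ≥0∞} (hε : ε ≠ 0) :
    ∃ g : Γ → E, eLpNorm (f - g) 1 μ ≤ ε ∧ Continuous g ∧ Integrable g μ := by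
  have key : ∀ (c : E) ⦃s : Set Γ⦄, MeasurableSet s → μ s < ∞ → ∀ {ε : ℝ≥0∞}, ε ≠ 0 →
      ∃ g : Γ → E, eLpNorm (g - s.indicator fun _ => c) 1 μ ≤ ε ∧
        (Continuous g ∧ Integrable g μ) := by
    intro c s hs hμs ε hε
    obtain ⟨η, hη, hηε⟩ := exists_eLpNorm_indicator_le (μ := μ) ENNReal.one_ne_top c hε
    have hη2 : (η : ℝ≥0∞) / 2 ≠ 0 := (ENNReal.half_pos (ENNReal.coe_pos.2 hη).ne').ne'
    obtain ⟨K, hKs, hK, hKc, hKμ⟩ := hs.exists_isCompact_isClosed_sdiff_lt hμs.ne hη2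
    obtain ⟨V, hKV, hV, -, hVμ⟩ :=
      hKc.measurableSet.exists_isOpen_sdiff_lt (hK.measure_lt_top (μ := μ)).ne hη2
    obtain ⟨χ, hχ1, hχ0, hχc, hχr⟩ := exists_continuous_one_zero_of_isCompact hK hV.isClosed_compl
      (Set.disjoint_compl_right_iff_subset.2 hKV)
    have hχcont : Continuous fun x => χ x • c := χ.continuous.smul continuous_const
    refine ⟨fun x => χ x • c, ?_, hχcont, ?_⟩
    · refine (eLpNorm_mono (g := ((V \ K) ∪ (s \ K)).indicator fun _ => c) fun x => ?_).trans
        (hηε _ ?_)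
      · by_cases hxK : x ∈ K
        · simp [hχ1 hxK, hKs hxK]
        by_cases hxs : x ∈ s
        · have hx : x ∈ (V \ K) ∪ (s \ K) := Or.inr ⟨hxs, hxK⟩
          rw [Set.indicator_of_mem hx, Pi.sub_apply, Set.indicator_of_mem hxs]
          have : χ x • c - c = (χ x - 1) • c := by rw [sub_smul, one_smul]
          rw [this, norm_smul]
          refine mul_le_of_le_one_left (norm_nonneg _) ?_
          rw [Real.norm_eq_abs, abs_le]
          constructor <;> linarith [(hχr x).1, (hχr x).2]
        · rw [Pi.sub_apply, Set.indicator_of_notMem hxs, sub_zero]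
          by_cases hxV : x ∈ V
          · have hx : x ∈ (V \ K) ∪ (s \ K) := Or.inl ⟨hxV, hxK⟩
            rw [Set.indicator_of_mem hx, norm_smul]
            refine mul_le_of_le_one_left (norm_nonneg _) ?_
            rw [Real.norm_of_nonneg (hχr x).1]
            exact (hχr x).2
          · simp [hχ0 hxV]
      · exact (measure_union_le _ _).trans
          ((add_le_add hVμ.le hKμ.le).trans (ENNReal.add_halves _).le)
    · refine hχcont.integrable_of_hasCompactSupport ?_
      exact HasCompactSupport.intro hχc.isCompact fun x hx => by
        simp [image_eq_zero_of_notMem_tsupport hx]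
  exact MemLp.induction_dense ENNReal.one_ne_top (fun g => Continuous g ∧ Integrable g μ) key
    (fun f g h1 h2 => ⟨h1.1.add h2.1, h1.2.add h2.2⟩) (fun f h => h.2.aestronglyMeasurable)
    (memLp_one_iff_integrable.2 hf) hε

end LocallyCompact

section GroupMeasurability

variable {Γ : Type*} [Group Γ] [TopologicalSpace Γ] [IsTopologicalGroup Γ] [LocallyCompactSpace Γ]
  [MeasurableSpace Γ] [BorelSpace Γ] {E : Type*} [NormedAddCommGroup E]

/-- A continuous function of the product `xy` is strongly measurable for the product of the Borel
`σ`-algebras, after multiplication with cutoff functions, although multiplication need not be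
measurable for this `σ`-algebra. -/
theorem exists_stronglyMeasurable_mul [NormedSpace ℝ E] {g : Γ → E} (hg : Continuous g)
    {K L : Set Γ} (hK : IsCompact K) (hL : IsCompact L) :
    ∃ φ : Γ × Γ → E, StronglyMeasurable φ ∧ ∀ z ∈ K ×ˢ L, φ z = g (z.1 * z.2) := by
  obtain ⟨χ, hχ, -, hχc, -⟩ := exists_continuous_one_zero_of_isCompact hK isClosed_empty
    (Set.disjoint_empty K)
  obtain ⟨ψ, hψ, -, hψc, -⟩ := exists_continuous_one_zero_of_isCompact hL isClosed_empty
    (Set.disjoint_empty L)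
  refine ⟨fun z => (χ z.1 * ψ z.2) • g (z.1 * z.2), ?_, fun z hz => ?_⟩
  · refine HasCompactSupport.stronglyMeasurable_of_prod (by fun_prop) ?_
    refine HasCompactSupport.intro (hχc.isCompact.prod hψc.isCompact) fun z hz => ?_
    rw [Set.mem_prod, not_and_or] at hz
    rcases hz with hz | hz
    · simp [image_eq_zero_of_notMem_tsupport hz]
    · simp [image_eq_zero_of_notMem_tsupport hz]
  · simp [hχ hz.1, hψ hz.2]

variable (μ : Measure Γ) [μ.IsHaarMeasure] [μ.Regular]

theorem quasiMeasurePreserving_twoSided (a b : Γ) :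
    Measure.QuasiMeasurePreserving (fun m : Γ => a * m * b) μ μ := by
  have h1 : Measure.QuasiMeasurePreserving (fun m : Γ => a * m) μ μ :=
    (measurePreserving_mul_left μ a).quasiMeasurePreserving
  have h2 : Measure.QuasiMeasurePreserving (fun m : Γ => m * b) μ μ := by
    refine ⟨(continuous_mul_const b).measurable, ?_⟩
    have : (Measure.map (fun m : Γ => m * b) μ).Regular :=
      Measure.Regular.map (Homeomorph.mulRight b)
    rw [Measure.isMulLeftInvariant_eq_smul_of_regular (Measure.map (fun m : Γ => m * b) μ) μ]
    exact Measure.smul_absolutelyContinuous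
  exact h2.comp h1

theorem aestronglyMeasurable_comp_twoSided {F : Γ → E} (a b : Γ)
    (hF : ∀ K, IsCompact K → AEStronglyMeasurable F (μ.restrict K)) {K : Set Γ}
    (hK : IsCompact K) : AEStronglyMeasurable (fun m => F (a * m * b)) (μ.restrict K) := by
  have hK' : IsCompact ((fun m : Γ => a * m * b) '' K) := hK.image (by fun_prop)
  have hq := (quasiMeasurePreserving_twoSided μ a b).restrict (s := K)
    (t := (fun m : Γ => a * m * b) '' K) (Set.mapsTo_image _ _)
  exact (hF _ hK').comp_quasiMeasurePreserving hq

variable [T2Space Γ]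

/-- A property that holds almost everywhere on `KL` holds at `xy` for almost all `(x, y)` in
`K × L`. As multiplication may fail to be measurable for the product `σ`-algebra, the exceptional
null set first has to be enlarged to one that is described by countably many continuous functions;
this is the completion regularity of Haar measure. -/
theorem ae_prod_mul {K L : Set Γ} (hK : IsCompact K) (hL : IsCompact L) {p : Γ → Prop}
    (hp : ∀ᵐ x ∂μ.restrict (K * L), p x) :
    ∀ᵐ z ∂(μ.restrict K).prod (μ.restrict L), p (z.1 * z.2) := by
  have hQ : IsCompact (K * L) := hK.mul hL
  have hQm : MeasurableSet (K * L) := hQ.measurableSet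
  have : IsFiniteMeasure (μ.restrict K) := ⟨by simpa using hK.measure_lt_top⟩
  have : IsFiniteMeasure (μ.restrict L) := ⟨by simpa using hL.measure_lt_top⟩
  rw [ae_restrict_iff' hQm, ae_iff] at hp
  set M := toMeasurable μ {x | ¬ (x ∈ K * L → p x)} with hM
  have hM0 : μ M = 0 := by rw [hM, measure_toMeasurable, hp]
  have hMp : ∀ x ∈ K * L, x ∉ M → p x := fun x hx hxM => by
    by_contra hcon
    exact hxM (subset_toMeasurable _ _ (by simpa using ⟨hx, hcon⟩))
  have hQM : μ ((K * L) \ M) = μ (K * L) := measure_sdiff_null hM0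
  have hQtop : μ (K * L) ≠ ∞ := hQ.measure_lt_top.ne
  have hex : ∀ n : ℕ, ∃ f : Γ → ℝ, Continuous f ∧ f ⁻¹' {1} ⊆ (K * L) \ M ∧
      μ (K * L) - ((n : ℝ≥0∞) + 1)⁻¹ ≤ μ (f ⁻¹' {1}) := by
    intro n
    rcases eq_or_ne (μ (K * L)) 0 with h0 | h0
    · exact ⟨fun _ => 0, continuous_const, fun x hx => by simp at hx, by simp [h0]⟩
    · have hlt : μ (K * L) - ((n : ℝ≥0∞) + 1)⁻¹ < μ ((K * L) \ M) := by
        rw [hQM]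
        exact ENNReal.sub_lt_self hQtop h0 (by simp)
      obtain ⟨s, hs, ⟨f, hf, -, rfl⟩, hr⟩ :=
        Measure.innerRegularWRT_preimage_one_hasCompactSupport_measure_ne_top_of_group (μ := μ)
          ⟨hQm.diff (measurableSet_toMeasurable _ _), by rwa [hQM]⟩ _ hlt
      exact ⟨f, hf, hs, hr.le⟩
  choose f hf hfs hfμ using hex
  -- The set of points that are missed by all the level sets is null.
  have hnull : μ ((K * L) \ ⋃ n, f n ⁻¹' {1}) = 0 := by
    refine le_antisymm (ge_of_tendsto' (x := atTop) (f := fun n : ℕ => ((n : ℝ≥0∞) + 1)⁻¹) ?_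
      fun n => ?_) zero_le
    · have := (ENNReal.tendsto_inv_nat_nhds_zero).comp (tendsto_add_atTop_nat 1)
      refine this.congr fun n => ?_
      simp
    · have hm : MeasurableSet (f n ⁻¹' {1}) := (hf n).measurable (measurableSet_singleton 1)
      have hsub : f n ⁻¹' {1} ⊆ K * L := (hfs n).trans Set.sdiff_subset
      calc μ ((K * L) \ ⋃ n, f n ⁻¹' {1}) ≤ μ ((K * L) \ f n ⁻¹' {1}) :=
            measure_mono (Set.sdiff_subset_sdiff_right (Set.subset_iUnion (fun n => f n ⁻¹' {1}) n))
        _ = μ (K * L) - μ (f n ⁻¹' {1}) := measure_sdiff hsub hm.nullMeasurableSet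
            ((measure_mono hsub).trans_lt hQ.measure_lt_top).ne
        _ ≤ ((n : ℝ≥0∞) + 1)⁻¹ := by
            rw [tsub_le_iff_left]
            exact tsub_le_iff_right.1 (hfμ n)
  choose φ hφ hφf using fun n => exists_stronglyMeasurable_mul (hf n) hK hL
  set B : Set (Γ × Γ) := (K ×ˢ L) ∩ ⋂ n, (φ n ⁻¹' {1})ᶜ with hB
  have hBm : MeasurableSet B := (hK.measurableSet.prod hL.measurableSet).inter
    (MeasurableSet.iInter fun n => ((hφ n).measurable (measurableSet_singleton 1)).compl)
  have hB0 : (μ.restrict K).prod (μ.restrict L) B = 0 := by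
    rw [Measure.measure_prod_null hBm]
    refine Eventually.of_forall fun x => ?_
    refine le_antisymm ?_ zero_le
    by_cases hx : x ∈ K
    · calc (μ.restrict L) (Prod.mk x ⁻¹' B) ≤ μ (Prod.mk x ⁻¹' B) :=
            Measure.restrict_apply_le _ _
        _ = μ (x • (Prod.mk x ⁻¹' B)) := (measure_smul μ x _).symm
        _ ≤ μ ((K * L) \ ⋃ n, f n ⁻¹' {1}) := by
            refine measure_mono ?_
            rintro _ ⟨y, hy, rfl⟩
            refine ⟨Set.mul_mem_mul hx hy.1.2, fun hcon => ?_⟩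
            obtain ⟨n, hn⟩ := Set.mem_iUnion.1 hcon
            refine Set.mem_iInter.1 hy.2 n ?_
            rw [Set.mem_preimage, hφf n _ hy.1]
            exact hn
        _ = 0 := hnull
    · have : Prod.mk x ⁻¹' B = ∅ := Set.eq_empty_of_forall_notMem fun y hy => hx hy.1.1
      simp [this]
  filter_upwards [ae_mem_prod μ hK hL, measure_eq_zero_iff_ae_notMem.1 hB0] with z hz hzB
  have : ∃ n, φ n z = 1 := by
    by_contra hcon
    push Not at hcon
    exact hzB ⟨hz, Set.mem_iInter.2 fun n => by simpa using hcon n⟩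
  obtain ⟨n, hn⟩ := this
  rw [hφf n z hz] at hn
  have := hfs n (show z.1 * z.2 ∈ f n ⁻¹' {1} from hn)
  exact hMp _ this.1 this.2

/-- The function `(x, y) ↦ F(xy)` is measurable with respect to the product measure on `K × L` if
`F` is bounded and measurable on `KL`. -/
theorem aestronglyMeasurable_prod_mul [NormedSpace ℝ E] {K L : Set Γ} (hK : IsCompact K)
    (hL : IsCompact L) {F : Γ → E} {C : ℝ} (hC : ∀ x, ‖F x‖ ≤ C)
    (hF : AEStronglyMeasurable F (μ.restrict (K * L))) :
    AEStronglyMeasurable (fun z : Γ × Γ => F (z.1 * z.2))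
      ((μ.restrict K).prod (μ.restrict L)) := by
  have hQ : IsCompact (K * L) := hK.mul hL
  have hQm : MeasurableSet (K * L) := hQ.measurableSet
  have : IsFiniteMeasure (μ.restrict K) := ⟨by simpa using hK.measure_lt_top⟩
  have : IsFiniteMeasure (μ.restrict L) := ⟨by simpa using hL.measure_lt_top⟩
  have hint : Integrable ((K * L).indicator F) μ :=
    (integrable_indicator_iff hQm).2 <|
      IntegrableOn.of_bound hQ.measure_lt_top hF C (Eventually.of_forall hC)
  choose g hgl hgcont hgint using fun n : ℕ =>
    exists_continuous_eLpNorm_one_sub_le μ hint (ε := ((n : ℝ≥0∞) + 1)⁻¹) (by simp)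
  have hmeas : TendstoInMeasure μ g atTop ((K * L).indicator F) := by
    refine tendstoInMeasure_of_tendsto_eLpNorm one_ne_zero
      (fun n => (hgint n).aestronglyMeasurable) hint.aestronglyMeasurable ?_
    have h0 : Tendsto (fun n : ℕ => ((n : ℝ≥0∞) + 1)⁻¹) atTop (𝓝 0) := by
      refine ((ENNReal.tendsto_inv_nat_nhds_zero).comp (tendsto_add_atTop_nat 1)).congr
        fun n => ?_
      simp
    refine tendsto_of_tendsto_of_tendsto_of_le_of_le tendsto_const_nhds h0
      (fun n => zero_le) fun n => ?_
    rw [eLpNorm_sub_comm]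
    exact hgl n
  obtain ⟨ns, -, hns⟩ := hmeas.exists_seq_tendsto_ae
  have hns' : ∀ᵐ x ∂μ.restrict (K * L), Tendsto (fun i => g (ns i) x) atTop (𝓝 (F x)) := by
    filter_upwards [ae_restrict_of_ae hns, ae_restrict_mem hQm] with x h1 h2
    rwa [Set.indicator_of_mem h2] at h1
  refine aestronglyMeasurable_of_tendsto_ae atTop (fun i => ?_) (ae_prod_mul μ hK hL hns')
  obtain ⟨φ, hφ, hφg⟩ := exists_stronglyMeasurable_mul (hgcont (ns i)) hK hL
  refine hφ.aestronglyMeasurable.congr ?_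
  filter_upwards [ae_mem_prod μ hK hL] with z hz
  exact hφg z hz

end GroupMeasurability

/-! ### Measurable families of operators -/

section OperatorFamilies

/-- A strongly measurable family of continuous maps can be applied to a measurable function. -/
theorem aestronglyMeasurable_apply_family {α H H' : Type*} [MeasurableSpace α] {ν : Measure α}
    [NormedAddCommGroup H] [NormedAddCommGroup H'] {T : α → H → H'}
    (hT : ∀ v, AEStronglyMeasurable (fun m => T m v) ν) (hc : ∀ m, Continuous (T m)) {w : α → H}
    (hw : AEStronglyMeasurable w ν) : AEStronglyMeasurable (fun m => T m (w m)) ν := by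
  have hs : ∀ s : SimpleFunc α H, AEStronglyMeasurable (fun m => T m (s m)) ν := by
    intro s
    have e : (fun m => T m (s m)) =
        fun m => ∑ y ∈ s.range, (s ⁻¹' {y}).indicator (fun m => T m y) m := by
      funext m
      rw [Finset.sum_eq_single (s m)]
      · simp
      · intro y _ hy
        exact Set.indicator_of_notMem (by simpa using hy.symm) _
      · exact fun h => (h (s.mem_range_self m)).elim
    rw [e]
    exact Finset.aestronglyMeasurable_fun_sum _ fun y _ =>
      (hT y).indicator (s.measurableSet_fiber y)
  have hlim : ∀ᵐ m ∂ν, Tendsto (fun n => T m (hw.stronglyMeasurable_mk.approx n m)) atTop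
      (𝓝 (T m (w m))) := by
    filter_upwards [hw.ae_eq_mk] with m hm
    rw [hm]
    exact ((hc m).tendsto _).comp (hw.stronglyMeasurable_mk.tendsto_approx m)
  exact aestronglyMeasurable_of_tendsto_ae atTop (fun n => hs _) hlim

variable {X : Type*} [MeasurableSpace X] {P : Measure X} [IsProbabilityMeasure P]
  {α : Type*} [MeasurableSpace α] {ν : Measure α}

theorem exists_smul_toL2_eq (s : Lp.simpleFunc ℂ 2 P) :
    ∃ (c : ℂ) (b : unitBall P), c • toL2 b = (s : Lp ℂ 2 P) := by
  obtain ⟨C, hC⟩ := (Lp.simpleFunc.toSimpleFunc s).exists_forall_norm_le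
  set D : ℝ := max C 1
  have hD : 0 < D := lt_max_of_lt_right one_pos
  obtain ⟨b, hb⟩ := exists_toL2_eq (P := P) (v := ((D : ℂ)⁻¹) • (s : Lp ℂ 2 P)) (by
    filter_upwards [Lp.coeFn_smul ((D : ℂ)⁻¹) (s : Lp ℂ 2 P),
      Lp.simpleFunc.toSimpleFunc_eq_toFun s] with x h1 h2
    rw [h1, Pi.smul_apply, ← h2, norm_smul, norm_inv, Complex.norm_real,
      Real.norm_of_nonneg hD.le, inv_mul_le_iff₀ hD, mul_one]
    exact (hC x).trans (le_max_left _ _))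
  refine ⟨D, b, ?_⟩
  rw [hb, smul_smul, mul_inv_cancel₀ (Complex.ofReal_ne_zero.2 hD.ne'), one_smul]

theorem aestronglyMeasurable_mulOp {w : α → unitBall P}
    (hw : AEStronglyMeasurable (fun m => toL2 (w m)) ν) (v : Lp ℂ 2 P) :
    AEStronglyMeasurable (fun m => mulOp (w m) v) ν := by
  refine (Lp.simpleFunc.denseRange (p := 2) (E := ℂ) (μ := P) (by simp)).induction_on
    (p := fun v => AEStronglyMeasurable (fun m => mulOp (w m) v) ν) v ?_ ?_
  · refine IsSeqClosed.isClosed fun u v hu huv => ?_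
    exact aestronglyMeasurable_of_tendsto_ae atTop hu
      (Eventually.of_forall fun m => ((mulOp (w m)).continuous.tendsto v).comp huv)
  · intro s
    obtain ⟨c, b, hcb⟩ := exists_smul_toL2_eq s
    have e : (fun m => mulOp (w m) (s : Lp ℂ 2 P)) = fun m => c • mulOp b (toL2 (w m)) := by
      funext m
      rw [← hcb, map_smul, mulOp_toL2, mulOp_toL2, mul_comm]
    rw [e]
    exact ((mulOp b).continuous.comp_aestronglyMeasurable hw).const_smul c

theorem aestronglyMeasurable_toL2_mul {w w' : α → unitBall P}
    (hw : AEStronglyMeasurable (fun m => toL2 (w m)) ν)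
    (hw' : AEStronglyMeasurable (fun m => toL2 (w' m)) ν) :
    AEStronglyMeasurable (fun m => toL2 (w m * w' m)) ν :=
  aestronglyMeasurable_apply_family (T := fun m v => mulOp (w m) v)
    (aestronglyMeasurable_mulOp hw) (fun m => (mulOp (w m)).continuous) hw'

theorem aestronglyMeasurable_toL2_prod {ι : Type*} (s : Finset ι) {w : ι → α → unitBall P}
    (hw : ∀ i ∈ s, AEStronglyMeasurable (fun m => toL2 (w i m)) ν) :
    AEStronglyMeasurable (fun m => toL2 (∏ i ∈ s, w i m)) ν := by
  classical
  induction s using Finset.induction with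
  | empty => simpa using aestronglyMeasurable_const
  | insert i s hi ih =>
    simp only [Finset.prod_insert hi]
    exact aestronglyMeasurable_toL2_mul (hw i (Finset.mem_insert_self _ _))
      (ih fun k hk => hw k (Finset.mem_insert_of_mem hk))

theorem aestronglyMeasurable_koopman_apply {g : α → koopmanGroup P}
    (hg : ∀ v, AEStronglyMeasurable (fun m => (g m).1 v) ν) {w : α → Lp ℂ 2 P}
    (hw : AEStronglyMeasurable w ν) : AEStronglyMeasurable (fun m => (g m).1 (w m)) ν :=
  aestronglyMeasurable_apply_family (T := fun m v => (g m).1 v) hg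
    (fun m => (g m).1.continuous) hw

end OperatorFamilies

/-! ### Products along systems -/

section SystemProduct

variable {Γ M G : Type*} [CommMonoid M] [Group G] [MulDistribMulAction G M]

/-- The product `∏ g(m) f_g` over the maps `g` in the system `S`. Multiple occurrences of a map in a
product of this kind can be merged, and hence a system is a set and not a tuple of maps. -/
def systemProduct (S : Finset (Γ → G)) (f : (Γ → G) → M) (m : Γ) : M := ∏ g ∈ S, g m • f g

open scoped Classical in
theorem exists_systemProduct_union (S T : Finset (Γ → G)) (f f' : (Γ → G) → M) :
    ∃ F : (Γ → G) → M, ∀ m,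
      systemProduct (S ∪ T) F m = systemProduct S f m * systemProduct T f' m := by
  refine ⟨fun g => (if g ∈ S then f g else 1) * (if g ∈ T then f' g else 1), fun m => ?_⟩
  simp only [systemProduct, smul_mul', Finset.prod_mul_distrib, smul_ite, smul_one]
  rw [Finset.prod_ite_mem, Finset.prod_ite_mem, Finset.inter_eq_right.2 Finset.subset_union_left,
    Finset.inter_eq_right.2 Finset.subset_union_right]

open scoped Classical in
/-- Products along a family of maps, in which repetitions may occur, are products along the system
of these maps. -/
theorem exists_systemProduct_image {ι : Type*} (s : Finset ι) (ψ : ι → Γ → G) (f : ι → M) :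
    ∃ F : (Γ → G) → M, ∀ m, systemProduct (s.image ψ) F m = ∏ i ∈ s, ψ i m • f i := by
  refine ⟨fun k => ∏ i ∈ s with ψ i = k, f i, fun m => ?_⟩
  rw [systemProduct, ← Finset.prod_fiberwise_of_maps_to (t := s.image ψ) (g := ψ)
    (fun i hi => Finset.mem_image_of_mem ψ hi)]
  refine Finset.prod_congr rfl fun k _ => ?_
  rw [Finset.smul_prod']
  refine Finset.prod_congr rfl fun i hi => ?_
  rw [(Finset.mem_filter.1 hi).2]

variable [Group Γ]

open scoped Classical in
/-- The expressions that arise from inserting a structured function in place of `f_g` are products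
along the reduced system. -/
theorem exists_systemProduct_reducedSystem {S : Finset (Γ → G)} (h1 : 1 ∈ S) {g : Γ → G}
    (hg : g ≠ 1) (f f' : (Γ → G) → M) (c : M) (a b : Γ) :
    ∃ F : (Γ → G) → M, ∀ m, systemProduct (reducedSystem S g a b) F m =
      systemProduct (S.erase g) f m *
        g m • (g (a * m * b))⁻¹ • (c * systemProduct (S.erase g) f' (a * m * b)) := by
  have h1' : (1 : Γ → G) ∈ S.erase g := Finset.mem_erase.2 ⟨hg.symm, h1⟩
  obtain ⟨F₁, hF₁⟩ := exists_systemProduct_image (S.erase g) (fun h => reduct g h a b)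
    (fun h => if h = 1 then c * f' h else f' h)
  obtain ⟨F, hF⟩ := exists_systemProduct_union (S.erase g)
    ((S.erase g).image (fun h => reduct g h a b)) f F₁
  refine ⟨F, fun m => ?_⟩
  rw [reducedSystem, hF, hF₁]
  congr 1
  simp only [systemProduct, reduct, mul_smul]
  rw [← Finset.smul_prod', ← Finset.smul_prod']
  congr 2
  rw [← Finset.mul_prod_erase _ _ h1', ← Finset.mul_prod_erase (S.erase g) _ h1', if_pos rfl,
    Pi.one_apply, one_smul, one_smul, mul_assoc]
  congr 2
  refine Finset.prod_congr rfl fun h hh => ?_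
  rw [if_neg (Finset.ne_of_mem_erase hh)]

end SystemProduct

/-! ### Measurability of the products -/

section ProductMeasurability

theorem aestronglyMeasurable_systemProduct {Γ : Type*}
    [TopologicalSpace Γ] [MeasurableSpace Γ] {μ : Measure Γ} {X : Type*} [MeasurableSpace X]
    {P : Measure X} [IsProbabilityMeasure P] {S : Finset (Γ → koopmanGroup P)}
    (hS : ∀ h ∈ S, IsMeasurableMap μ h)
    (f : (Γ → koopmanGroup P) → unitBall P) {K : Set Γ} (hK : IsCompact K) :
    AEStronglyMeasurable (fun m => toL2 (systemProduct S f m)) (μ.restrict K) :=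
  aestronglyMeasurable_toL2_prod S fun h hh => (hS h hh K hK (toL2 (f h))).1

variable {Γ : Type*} [Group Γ] [TopologicalSpace Γ] [IsTopologicalGroup Γ] [LocallyCompactSpace Γ]
  [MeasurableSpace Γ] [BorelSpace Γ] {μ : Measure Γ} [μ.IsHaarMeasure] [μ.Regular]
  {X : Type*} [MeasurableSpace X] {P : Measure X} [IsProbabilityMeasure P]

theorem isMeasurableMap_reduct {g h : Γ → koopmanGroup P} (hg : IsMeasurableMap μ g)
    (hh : IsMeasurableMap μ h) (a b : Γ) : IsMeasurableMap μ (reduct g h a b) := by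
  intro K hK f
  have hg1 := fun v => (hg K hK v).1
  have hg2 := fun v => (hg K hK v).2
  have hg3 := fun v => aestronglyMeasurable_comp_twoSided μ a b (fun K hK => (hg K hK v).1) hK
  have hg4 := fun v => aestronglyMeasurable_comp_twoSided μ a b (fun K hK => (hg K hK v).2) hK
  have hh3 := fun v => aestronglyMeasurable_comp_twoSided μ a b (fun K hK => (hh K hK v).1) hK
  have hh4 := fun v => aestronglyMeasurable_comp_twoSided μ a b (fun K hK => (hh K hK v).2) hK
  constructor
  · exact aestronglyMeasurable_koopman_apply hg1
      (aestronglyMeasurable_koopman_apply (g := fun m => (g (a * m * b))⁻¹) hg4 (hh3 f))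
  · have := aestronglyMeasurable_koopman_apply (g := fun m => (h (a * m * b))⁻¹) hh4
      (aestronglyMeasurable_koopman_apply hg3 (hg2 f))
    refine this.congr (Eventually.of_forall fun m => ?_)
    change _ = ((reduct g h a b m)⁻¹).1 f
    have e : (reduct g h a b m)⁻¹
        = (h (a * m * b))⁻¹ * (g (a * m * b) * (g m)⁻¹) := by
      simp only [reduct]; group
    rw [e]
    rfl

theorem isMeasurableMap_reducedSystem {S : Finset (Γ → koopmanGroup P)}
    (hS : ∀ h ∈ S, IsMeasurableMap μ h) {g : Γ → koopmanGroup P} (hg : g ∈ S) (a b : Γ) :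
    ∀ h ∈ reducedSystem S g a b, IsMeasurableMap μ h := by
  classical
  intro k hk
  rcases Finset.mem_union.1 hk with hk | hk
  · exact hS k (Finset.mem_of_mem_erase hk)
  · obtain ⟨h, hh, rfl⟩ := Finset.mem_image.1 hk
    exact isMeasurableMap_reduct (hS g hg) (hS h (Finset.mem_of_mem_erase hh)) a b

/-- The family `(m, n) ↦ g(amn)` and its inverse are strongly measurable on products of compact
sets. -/
theorem aestronglyMeasurable_prod_koopman [T2Space Γ] {g : Γ → koopmanGroup P}
    (hg : IsMeasurableMap μ g) (a : Γ) {K L : Set Γ} (hK : IsCompact K) (hL : IsCompact L)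
    (v : Lp ℂ 2 P) :
    AEStronglyMeasurable (fun z : Γ × Γ => (g (a * z.1 * z.2)).1 v)
      ((μ.restrict K).prod (μ.restrict L)) ∧
    AEStronglyMeasurable (fun z : Γ × Γ => (g (a * z.1 * z.2)).1⁻¹ v)
      ((μ.restrict K).prod (μ.restrict L)) := by
  constructor
  · have h := aestronglyMeasurable_comp_twoSided μ a 1 (fun K hK => (hg K hK v).1) (hK.mul hL)
    have := aestronglyMeasurable_prod_mul μ hK hL (C := ‖v‖)
      (fun x => ((g (a * x * 1)).1.norm_map v).le) h
    simpa only [mul_one, mul_assoc] using this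
  · have h := aestronglyMeasurable_comp_twoSided μ a 1 (fun K hK => (hg K hK v).2) (hK.mul hL)
    have := aestronglyMeasurable_prod_mul μ hK hL (C := ‖v‖)
      (fun x => ((g (a * x * 1)).1⁻¹.norm_map v).le) h
    simpa only [mul_one, mul_assoc] using this

end ProductMeasurability

/-! ### Averages over sets -/

section Averages

open scoped NNReal

variable {Γ : Type*} [MeasurableSpace Γ] {E : Type*} [NormedAddCommGroup E] {μ : Measure Γ}

theorem aestronglyMeasurable_cond {Ψ : Set Γ} {F : Γ → E}
    (hF : AEStronglyMeasurable F (μ.restrict Ψ)) :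
    AEStronglyMeasurable F (ProbabilityTheory.cond μ Ψ) :=
  hF.mono_ac Measure.smul_absolutelyContinuous

theorem aestronglyMeasurable_cond_prod {Ψ Φ : Set Γ} {F : Γ × Γ → E}
    [SFinite (μ.restrict Ψ)] [SFinite (μ.restrict Φ)]
    (hF : AEStronglyMeasurable F ((μ.restrict Ψ).prod (μ.restrict Φ))) :
    AEStronglyMeasurable F
      ((ProbabilityTheory.cond μ Ψ).prod (ProbabilityTheory.cond μ Φ)) :=
  hF.mono_ac (Measure.AbsolutelyContinuous.prod Measure.smul_absolutelyContinuous
    Measure.smul_absolutelyContinuous)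

variable [NormedSpace ℝ E]

theorem integral_cond (Φ : Set Γ) (F : Γ → E) :
    ∫ x, F x ∂(ProbabilityTheory.cond μ Φ) = (μ.real Φ)⁻¹ • ∫ x in Φ, F x ∂μ := by
  rw [ProbabilityTheory.cond, integral_smul_measure, ENNReal.toReal_inv]
  rfl

theorem setAverage_eq_integral_cond (Φ : Set Γ) (F : Γ → E) :
    ⨍ x in Φ, F x ∂μ = ∫ x, F x ∂(ProbabilityTheory.cond μ Φ) := by
  rw [average, Measure.restrict_apply_univ]
  rfl

theorem norm_integral_le_of_prob {α : Type*} [MeasurableSpace α] (ν : Measure α)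
    [IsProbabilityMeasure ν] {F : α → E} {C : ℝ} (hF : ∀ᵐ x ∂ν, ‖F x‖ ≤ C) :
    ‖∫ x, F x ∂ν‖ ≤ C := by
  simpa using norm_integral_le_of_norm_le_const hF

variable [Group Γ] [TopologicalSpace Γ] [IsTopologicalGroup Γ] [BorelSpace Γ]
  [μ.IsMulLeftInvariant]

theorem setIntegral_smul_set (a : Γ) (Φ : Set Γ) (F : Γ → E) :
    ∫ x in a • Φ, F x ∂μ = ∫ x in Φ, F (a * x) ∂μ := by
  have h := (measurePreserving_mul_left μ a).setIntegral_preimage_emb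
    (MeasurableEquiv.mulLeft a).measurableEmbedding F (a • Φ)
  rw [← h]
  congr 2
  ext x
  simp [Set.mem_smul_set_iff_inv_smul_mem]

theorem integral_cond_smul_set (a : Γ) (Φ : Set Γ) (F : Γ → E) :
    ∫ x, F x ∂(ProbabilityTheory.cond μ (a • Φ)) =
      ∫ x, F (a * x) ∂(ProbabilityTheory.cond μ Φ) := by
  rw [integral_cond, integral_cond, setIntegral_smul_set, Measure.real, Measure.real,
    measure_smul]

/-- Averages over an almost invariant set are almost invariant under translations. -/
theorem norm_integral_cond_sub_translate_le [T2Space Γ] [IsFiniteMeasureOnCompacts μ] {Φ : Set Γ}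
    (hΦ : IsCompact Φ) (hΦ0 : μ Φ ≠ 0) {γ : ℝ≥0} {m : Γ}
    (hm : μ ((m • Φ) ∆ Φ) ≤ γ * μ Φ) {F : Γ → E} (hF1 : ∀ x, ‖F x‖ ≤ 1)
    (hF : ∀ K, IsCompact K → AEStronglyMeasurable F (μ.restrict K)) :
    ‖∫ x, F x ∂(ProbabilityTheory.cond μ Φ) - ∫ x, F (m * x) ∂(ProbabilityTheory.cond μ Φ)‖ ≤
      γ := by
  have hint : ∀ K, IsCompact K → IntegrableOn F K μ := fun K hK =>
    IntegrableOn.of_bound hK.measure_lt_top (hF K hK) 1 (Eventually.of_forall hF1)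
  have hmΦ : IsCompact (m • Φ) := hΦ.smul m
  have h1 := integral_inter_add_sdiff hmΦ.measurableSet (hint Φ hΦ)
  have h2 := integral_inter_add_sdiff hΦ.measurableSet (hint _ hmΦ)
  have hpos : 0 < μ.real Φ := ENNReal.toReal_pos hΦ0 hΦ.measure_lt_top.ne
  have hfin1 : μ (Φ \ m • Φ) < ∞ := (measure_mono Set.sdiff_subset).trans_lt hΦ.measure_lt_top
  have hfin2 : μ (m • Φ \ Φ) < ∞ := (measure_mono Set.sdiff_subset).trans_lt hmΦ.measure_lt_top
  have hsymm : μ.real (Φ \ m • Φ) + μ.real (m • Φ \ Φ) ≤ γ * μ.real Φ := by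
    have e : μ ((m • Φ) ∆ Φ) = μ (m • Φ \ Φ) + μ (Φ \ m • Φ) :=
      measure_union (disjoint_sdiff_sdiff)
        (hΦ.measurableSet.diff hmΦ.measurableSet)
    have := ENNReal.toReal_mono
      (ENNReal.mul_ne_top ENNReal.coe_ne_top hΦ.measure_lt_top.ne) (e ▸ hm)
    rw [ENNReal.toReal_add hfin2.ne hfin1.ne, ENNReal.toReal_mul] at this
    rw [add_comm]
    exact this
  rw [integral_cond, integral_cond, ← setIntegral_smul_set, ← smul_sub, ← h1, ← h2, Set.inter_comm,
    add_sub_add_left_eq_sub, norm_smul, norm_inv, Real.norm_of_nonneg hpos.le,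
    inv_mul_le_iff₀ hpos]
  refine (norm_sub_le _ _).trans ?_
  have b1 := norm_setIntegral_le_of_norm_le_const (f := F) hfin1 (fun x _ => hF1 x)
  have b2 := norm_setIntegral_le_of_norm_le_const (f := F) hfin2 (fun x _ => hF1 x)
  rw [one_mul] at b1 b2
  calc _ ≤ _ := add_le_add b1 b2
    _ ≤ _ := hsymm
    _ = _ := mul_comm _ _

end Averages

/-! ### Averages along systems and structured functions -/

section Structured

open scoped InnerProductSpace NNReal

theorem inner_integral_left {α X : Type*} [MeasurableSpace α] [MeasurableSpace X]
    {P : Measure X} {ν : Measure α} {F : α → Lp ℂ 2 P} (hF : Integrable F ν) (u : Lp ℂ 2 P) :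
    ⟪∫ x, F x ∂ν, u⟫_ℂ = ∫ x, ⟪F x, u⟫_ℂ ∂ν := by
  rw [← inner_conj_symm, ← integral_inner hF, ← integral_conj]
  simp only [inner_conj_symm]

variable {Γ : Type*} [MeasurableSpace Γ] (μ : Measure Γ)
  {X : Type*} [MeasurableSpace X] {P : Measure X} [IsProbabilityMeasure P]

/-- The average over `Ψ` of the products `∏ g(m) f_g` along the system `S`. -/
noncomputable def systemAverage (S : Finset (Γ → koopmanGroup P))
    (f : (Γ → koopmanGroup P) → unitBall P) (Ψ : Set Γ) : Lp ℂ 2 P :=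
  ∫ m, toL2 (systemProduct S f m) ∂(ProbabilityTheory.cond μ Ψ)

open scoped Classical in
/-- The average over `Ψ` of the products along the system `S`, with `u` in the place of `f_g`; here
`u` need not be bounded. -/
noncomputable def slotAverage (S : Finset (Γ → koopmanGroup P)) (g : Γ → koopmanGroup P)
    (f : (Γ → koopmanGroup P) → unitBall P) (Ψ : Set Γ) (u : Lp ℂ 2 P) : Lp ℂ 2 P :=
  ∫ m, mulOp (systemProduct (S.erase g) f m) ((g m).1 u) ∂(ProbabilityTheory.cond μ Ψ)

open scoped Classical in
/-- The function by which the product at `x` along `S` is tested against `c`, when it is regarded as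
a linear functional of `f_g`. Structured functions are the averages of these functions. -/
noncomputable def structuredIntegrand (S : Finset (Γ → koopmanGroup P)) (g : Γ → koopmanGroup P)
    (f : (Γ → koopmanGroup P) → unitBall P) (c : unitBall P) (x : Γ) : unitBall P :=
  (g x)⁻¹ • (c * systemProduct (S.erase g) (fun h => star (f h)) x)

/-- The structured function by which the average over `aΦ` along `S` is tested against `c`. It is
written as an average over `Φ`, since it is `Φ` and not `aΦ` that is almost invariant. -/
noncomputable def structured [Mul Γ] (S : Finset (Γ → koopmanGroup P)) (g : Γ → koopmanGroup P)
    (f : (Γ → koopmanGroup P) → unitBall P) (c : unitBall P) (a : Γ) (Φ : Set Γ) : Lp ℂ 2 P :=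
  ∫ n, toL2 (structuredIntegrand S g f c (a * n)) ∂(ProbabilityTheory.cond μ Φ)

variable {S : Finset (Γ → koopmanGroup P)} {g : Γ → koopmanGroup P}
  {f : (Γ → koopmanGroup P) → unitBall P}

theorem systemAverage_eq_slotAverage (hg : g ∈ S) (Ψ : Set Γ) :
    systemAverage μ S f Ψ = slotAverage μ S g f Ψ (toL2 (f g)) := by
  classical
  refine integral_congr_ae (Eventually.of_forall fun m => ?_)
  change toL2 _ = toL2 (systemProduct (S.erase g) f m * g m • f g)
  rw [systemProduct, ← Finset.prod_erase_mul _ _ hg, systemProduct]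

omit [MeasurableSpace Γ] in
theorem inner_toL2_slot (S : Finset (Γ → koopmanGroup P)) (g : Γ → koopmanGroup P)
    (f : (Γ → koopmanGroup P) → unitBall P) (c : unitBall P) (u : Lp ℂ 2 P) (m : Γ) :
    open scoped Classical in
    ⟪toL2 c, mulOp (systemProduct (S.erase g) f m) ((g m).1 u)⟫_ℂ =
      ⟪toL2 (structuredIntegrand S g f c m), u⟫_ℂ := by
  classical
  have e : star (systemProduct (S.erase g) f m)
      = systemProduct (S.erase g) (fun h => star (f h)) m := by
    rw [systemProduct, star_prod_unitBall, systemProduct]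
    exact Finset.prod_congr rfl fun h _ => (koopman_smul_star _ _).symm
  have h1 := inner_mulOp (star (systemProduct (S.erase g) f m)) (toL2 c) ((g m).1 u)
  rw [star_star_unitBall] at h1
  rw [← h1, e, mulOp_toL2, mul_comm, structuredIntegrand, toL2_smul]
  have h2 := (g m).1.inner_map_map
    (((g m)⁻¹).1 (toL2 (c * systemProduct (S.erase g) (fun h => star (f h)) m))) u
  rw [← h2]
  congr 1
  exact ((g m).1.apply_symm_apply _).symm

variable {μ}

section Compact

variable [TopologicalSpace Γ]

theorem integrable_systemProduct [IsFiniteMeasureOnCompacts μ]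
    (hS : ∀ h ∈ S, IsMeasurableMap μ h) (f : (Γ → koopmanGroup P) → unitBall P) {Ψ : Set Γ}
    (hΨ : IsCompact Ψ) (hΨ0 : μ Ψ ≠ 0) :
    Integrable (fun m => toL2 (systemProduct S f m)) (ProbabilityTheory.cond μ Ψ) := by
  have := ProbabilityTheory.cond_isProbabilityMeasure_of_finite hΨ0 hΨ.measure_lt_top.ne
  exact Integrable.of_bound
    (aestronglyMeasurable_cond (aestronglyMeasurable_systemProduct hS f hΨ)) 1
    (Eventually.of_forall fun m => norm_toL2_le _)

theorem systemAverage_norm_le_one [IsFiniteMeasureOnCompacts μ]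
    (hS : ∀ h ∈ S, IsMeasurableMap μ h) (f : (Γ → koopmanGroup P) → unitBall P) {Ψ : Set Γ}
    (hΨ : IsCompact Ψ) (hΨ0 : μ Ψ ≠ 0) : ∀ᵐ x ∂P, ‖systemAverage μ S f Ψ x‖ ≤ 1 := by
  have := ProbabilityTheory.cond_isProbabilityMeasure_of_finite hΨ0 hΨ.measure_lt_top.ne
  exact convex_norm_le_one.integral_mem isClosed_norm_le_one
    (Eventually.of_forall fun m => unitBall_norm_le (systemProduct S f m))
    (integrable_systemProduct hS f hΨ hΨ0)

theorem norm_systemAverage_le [IsFiniteMeasureOnCompacts μ]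
    (S : Finset (Γ → koopmanGroup P)) (f : (Γ → koopmanGroup P) → unitBall P) {Ψ : Set Γ}
    (hΨ : IsCompact Ψ) (hΨ0 : μ Ψ ≠ 0) : ‖systemAverage μ S f Ψ‖ ≤ 1 := by
  have := ProbabilityTheory.cond_isProbabilityMeasure_of_finite hΨ0 hΨ.measure_lt_top.ne
  exact norm_integral_le_of_prob _ (Eventually.of_forall fun m => norm_toL2_le _)

open scoped Classical in
theorem integrable_slot [IsFiniteMeasureOnCompacts μ] (hS : ∀ h ∈ S, IsMeasurableMap μ h)
    (hg : g ∈ S) {Ψ : Set Γ} (hΨ : IsCompact Ψ) (hΨ0 : μ Ψ ≠ 0) (u : Lp ℂ 2 P) :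
    Integrable (fun m => mulOp (systemProduct (S.erase g) f m) ((g m).1 u))
      (ProbabilityTheory.cond μ Ψ) := by
  have := ProbabilityTheory.cond_isProbabilityMeasure_of_finite hΨ0 hΨ.measure_lt_top.ne
  refine Integrable.of_bound ?_ ‖u‖ (Eventually.of_forall fun m =>
    (norm_mulOp_le _ _).trans ((g m).1.norm_map u).le)
  refine aestronglyMeasurable_cond ?_
  exact aestronglyMeasurable_apply_family
    (T := fun m v => mulOp (systemProduct (S.erase g) f m) v)
    (aestronglyMeasurable_mulOp (aestronglyMeasurable_systemProduct
      (fun h hh => hS h (Finset.mem_of_mem_erase hh)) f hΨ))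
    (fun m => (mulOp _).continuous) (hS g hg Ψ hΨ u).1

theorem slotAverage_add_smul [IsFiniteMeasureOnCompacts μ] (hS : ∀ h ∈ S, IsMeasurableMap μ h)
    (hg : g ∈ S) {Ψ : Set Γ} (hΨ : IsCompact Ψ) (hΨ0 : μ Ψ ≠ 0) (u v : Lp ℂ 2 P) (c : ℂ) :
    slotAverage μ S g f Ψ (u + c • v) =
      slotAverage μ S g f Ψ u + c • slotAverage μ S g f Ψ v := by
  classical
  rw [slotAverage, slotAverage, slotAverage, ← integral_smul]
  refine Eq.trans ?_ (integral_add
    (integrable_slot hS hg hΨ hΨ0 u) ((integrable_slot hS hg hΨ hΨ0 v).smul c))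
  refine integral_congr_ae (Eventually.of_forall fun m => ?_)
  simp only [map_add, map_smul]

theorem aestronglyMeasurable_structuredIntegrand (hS : ∀ h ∈ S, IsMeasurableMap μ h) (hg : g ∈ S)
    (c : unitBall P) {K : Set Γ} (hK : IsCompact K) :
    AEStronglyMeasurable (fun x => toL2 (structuredIntegrand S g f c x)) (μ.restrict K) := by
  classical
  refine aestronglyMeasurable_koopman_apply (g := fun x => (g x)⁻¹) (fun v => (hS g hg K hK v).2)
    (aestronglyMeasurable_toL2_mul aestronglyMeasurable_const ?_)
  exact aestronglyMeasurable_systemProduct (fun h hh => hS h (Finset.mem_of_mem_erase hh)) _ hK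

theorem norm_structured_le [Mul Γ] [IsFiniteMeasureOnCompacts μ]
    (S : Finset (Γ → koopmanGroup P)) (g : Γ → koopmanGroup P)
    (f : (Γ → koopmanGroup P) → unitBall P) (c : unitBall P) (a : Γ) {Φ : Set Γ}
    (hΦ : IsCompact Φ) (hΦ0 : μ Φ ≠ 0) : ‖structured μ S g f c a Φ‖ ≤ 1 := by
  have := ProbabilityTheory.cond_isProbabilityMeasure_of_finite hΦ0 hΦ.measure_lt_top.ne
  exact norm_integral_le_of_prob _ (Eventually.of_forall fun m => norm_toL2_le _)

end Compact

end Structured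

section StructuredAverages

open scoped InnerProductSpace NNReal ComplexConjugate

variable {Γ : Type*} [Group Γ] [TopologicalSpace Γ] [IsTopologicalGroup Γ] [LocallyCompactSpace Γ]
  [MeasurableSpace Γ] [BorelSpace Γ] {μ : Measure Γ} [μ.IsHaarMeasure] [μ.Regular]
  {X : Type*} [MeasurableSpace X] {P : Measure X} [IsProbabilityMeasure P]
  {S : Finset (Γ → koopmanGroup P)} {g : Γ → koopmanGroup P}
  {f : (Γ → koopmanGroup P) → unitBall P}

theorem aestronglyMeasurable_structuredIntegrand_mul (hS : ∀ h ∈ S, IsMeasurableMap μ h)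
    (hg : g ∈ S) (c : unitBall P) (a : Γ) {K : Set Γ} (hK : IsCompact K) :
    AEStronglyMeasurable (fun x => toL2 (structuredIntegrand S g f c (a * x))) (μ.restrict K) := by
  simpa using aestronglyMeasurable_comp_twoSided μ a 1
    (fun K hK => aestronglyMeasurable_structuredIntegrand (f := f) hS hg c hK) hK

/-- Testing an average with `u` in the place of `f_g` amounts to testing `u` against a structured
function. -/
theorem inner_slotAverage (hS : ∀ h ∈ S, IsMeasurableMap μ h) (hg : g ∈ S) (c : unitBall P)
    (a : Γ) {Φ : Set Γ} (hΦ : IsCompact Φ) (hΦ0 : μ Φ ≠ 0) (u : Lp ℂ 2 P) :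
    ⟪toL2 c, slotAverage μ S g f (a • Φ) u⟫_ℂ = ⟪structured μ S g f c a Φ, u⟫_ℂ := by
  classical
  have := ProbabilityTheory.cond_isProbabilityMeasure_of_finite hΦ0 hΦ.measure_lt_top.ne
  have h0 : μ (a • Φ) ≠ 0 := by rwa [measure_smul]
  have hint : Integrable (fun n => toL2 (structuredIntegrand S g f c (a * n)))
      (ProbabilityTheory.cond μ Φ) :=
    Integrable.of_bound (aestronglyMeasurable_cond
      (aestronglyMeasurable_structuredIntegrand_mul hS hg c a hΦ)) 1
      (Eventually.of_forall fun m => norm_toL2_le _)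
  rw [slotAverage, ← integral_inner (integrable_slot hS hg (hΦ.smul a) h0 u), structured,
    inner_integral_left hint, integral_cond_smul_set]
  exact integral_congr_ae (Eventually.of_forall fun m => inner_toL2_slot S g f c u (a * m))

open scoped Classical in
/-- The product at `m` along the system `S`, with the integrand of a structured function, translated
by `m`, in the place of `f_g`. For fixed `n` this is a product along a reduced system. -/
noncomputable def structuredSlot (S : Finset (Γ → koopmanGroup P)) (g : Γ → koopmanGroup P)
    (f : (Γ → koopmanGroup P) → unitBall P) (c : unitBall P) (a : Γ) (z : Γ × Γ) : unitBall P :=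
  systemProduct (S.erase g) f z.1 *
    g z.1 • (g (a * z.1 * z.2))⁻¹ •
      (c * systemProduct (S.erase g) (fun h => star (f h)) (a * z.1 * z.2))

variable [T2Space Γ]

theorem aestronglyMeasurable_structuredSlot (hS : ∀ h ∈ S, IsMeasurableMap μ h) (hg : g ∈ S)
    (c : unitBall P) (a : Γ) {K L : Set Γ} (hK : IsCompact K) (hL : IsCompact L) :
    AEStronglyMeasurable (fun z => toL2 (structuredSlot S g f c a z))
      ((μ.restrict K).prod (μ.restrict L)) := by
  classical
  have : IsFiniteMeasure (μ.restrict K) := ⟨by simpa using hK.measure_lt_top⟩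
  have : IsFiniteMeasure (μ.restrict L) := ⟨by simpa using hL.measure_lt_top⟩
  have hS' : ∀ h ∈ S.erase g, IsMeasurableMap μ h := fun h hh =>
    hS h (Finset.mem_of_mem_erase hh)
  refine aestronglyMeasurable_toL2_mul
    (aestronglyMeasurable_systemProduct hS' f hK).comp_fst ?_
  refine aestronglyMeasurable_koopman_apply (g := fun z : Γ × Γ => g z.1)
    (fun v => (hS g hg K hK v).1.comp_fst) ?_
  refine aestronglyMeasurable_koopman_apply (g := fun z : Γ × Γ => (g (a * z.1 * z.2))⁻¹)
    (fun v => (aestronglyMeasurable_prod_koopman (hS g hg) a hK hL v).2) ?_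
  refine aestronglyMeasurable_toL2_mul aestronglyMeasurable_const ?_
  exact aestronglyMeasurable_toL2_prod _ fun h hh =>
    (aestronglyMeasurable_prod_koopman (hS' h hh) a hK hL (toL2 (star (f h)))).1

theorem integrable_structuredSlot (hS : ∀ h ∈ S, IsMeasurableMap μ h) (hg : g ∈ S)
    (c : unitBall P) (a : Γ) {Ψ Φ : Set Γ} (hΨ : IsCompact Ψ) (hΨ0 : μ Ψ ≠ 0)
    (hΦ : IsCompact Φ) (hΦ0 : μ Φ ≠ 0) :
    Integrable (fun z => toL2 (structuredSlot S g f c a z))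
      ((ProbabilityTheory.cond μ Ψ).prod (ProbabilityTheory.cond μ Φ)) := by
  have := ProbabilityTheory.cond_isProbabilityMeasure_of_finite hΨ0 hΨ.measure_lt_top.ne
  have := ProbabilityTheory.cond_isProbabilityMeasure_of_finite hΦ0 hΦ.measure_lt_top.ne
  have : IsFiniteMeasure (μ.restrict Ψ) := ⟨by simpa using hΨ.measure_lt_top⟩
  have : IsFiniteMeasure (μ.restrict Φ) := ⟨by simpa using hΦ.measure_lt_top⟩
  exact Integrable.of_bound (aestronglyMeasurable_cond_prod
    (aestronglyMeasurable_structuredSlot hS hg c a hΨ hΦ)) 1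
    (Eventually.of_forall fun m => norm_toL2_le _)

/-- If `Φ` is almost invariant under `Ψ`, then the average over `Ψ` of a structured function at `Φ`
is close to an average, over `n ∈ Φ`, of averages along reduced systems. -/
theorem norm_slotAverage_structured_sub_le (hS : ∀ h ∈ S, IsMeasurableMap μ h) (hg : g ∈ S)
    (c : unitBall P) (a : Γ) {Ψ Φ : Set Γ} (hΨ : IsCompact Ψ) (hΨ0 : μ Ψ ≠ 0)
    (hΦ : IsCompact Φ) (hΦ0 : μ Φ ≠ 0) {γ : ℝ≥0}
    (hγ : ∀ m ∈ Ψ, μ ((m • Φ) ∆ Φ) ≤ γ * μ Φ) :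
    ‖slotAverage μ S g f Ψ (structured μ S g f c a Φ) -
      ∫ n, (∫ m, toL2 (structuredSlot S g f c a (m, n)) ∂(ProbabilityTheory.cond μ Ψ))
        ∂(ProbabilityTheory.cond μ Φ)‖ ≤ γ := by
  classical
  have := ProbabilityTheory.cond_isProbabilityMeasure_of_finite hΨ0 hΨ.measure_lt_top.ne
  have := ProbabilityTheory.cond_isProbabilityMeasure_of_finite hΦ0 hΦ.measure_lt_top.ne
  have hint := integrable_structuredSlot (f := f) hS hg c a hΨ hΨ0 hΦ hΦ0
  have hswap := integral_integral_swap (f := fun m n => toL2 (structuredSlot S g f c a (m, n))) hint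
  rw [← hswap, slotAverage, ← integral_sub (integrable_slot hS hg hΨ hΨ0 _) hint.integral_prod_left]
  refine norm_integral_le_of_prob _ ?_
  have hmem : ∀ᵐ m ∂(ProbabilityTheory.cond μ Ψ), m ∈ Ψ :=
    Measure.smul_absolutelyContinuous.ae_le (ae_restrict_mem hΨ.measurableSet)
  filter_upwards [hmem] with m hm
  set F : Γ → Lp ℂ 2 P := fun x => toL2 (structuredIntegrand S g f c (a * x)) with hF
  have hFm : ∀ K, IsCompact K → AEStronglyMeasurable F (μ.restrict K) := fun K hK =>
    aestronglyMeasurable_structuredIntegrand_mul hS hg c a hK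
  have e : ∫ n, toL2 (structuredSlot S g f c a (m, n)) ∂(ProbabilityTheory.cond μ Φ) =
      mulOp (systemProduct (S.erase g) f m) ((g m).1
        (∫ n, F (m * n) ∂(ProbabilityTheory.cond μ Φ))) := by
    have hFi : Integrable (fun n => F (m * n)) (ProbabilityTheory.cond μ Φ) := by
      refine Integrable.of_bound (aestronglyMeasurable_cond ?_) 1
        (Eventually.of_forall fun m => norm_toL2_le _)
      simpa using aestronglyMeasurable_comp_twoSided μ m 1 hFm hΦ
    have h1 := ((mulOp (systemProduct (S.erase g) f m)).comp
      ((g m).1.toContinuousLinearEquiv : Lp ℂ 2 P →L[ℂ] Lp ℂ 2 P)).integral_comp_comm hFi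
    refine Eq.trans ?_ h1
    refine integral_congr_ae (Eventually.of_forall fun n => ?_)
    change toL2 (structuredSlot S g f c a (m, n)) = toL2 (systemProduct (S.erase g) f m *
      g m • structuredIntegrand S g f c (a * (m * n)))
    rw [structuredSlot, structuredIntegrand, ← mul_assoc a]
  rw [e, structured, ← map_sub, ← map_sub]
  refine (norm_mulOp_le _ _).trans ?_
  rw [(g m).1.norm_map]
  exact norm_integral_cond_sub_translate_le hΦ hΦ0 (hγ m hm) (fun x => norm_toL2_le _) hFm

end StructuredAverages

/-! ### Bounds for the jumps of averages -/

section AverageBound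

open scoped InnerProductSpace NNReal

variable {Γ : Type*} [Group Γ] [MeasurableSpace Γ] (μ : Measure Γ)
  {X : Type*} [MeasurableSpace X] (P : Measure X) [IsProbabilityMeasure P]

/-- A sequence of pairs of translates `aΦ` of compact sets of positive measure, such that each `Φ`
is almost invariant under all the translates in earlier pairs. No relation between the two members
of a pair is imposed. -/
structure IsSeparated [TopologicalSpace Γ] (γ : ℝ≥0) (Φ : ℕ → Bool → Set Γ) (a : ℕ → Bool → Γ) :
    Prop where
  isCompact : ∀ k b, IsCompact (Φ k b)
  measure_ne_zero : ∀ k b, μ (Φ k b) ≠ 0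
  almost_invariant : ∀ k k', k < k' → ∀ b b', ∀ m ∈ a k b • Φ k b,
    μ ((m • Φ k' b') ∆ Φ k' b') ≤ γ * μ (Φ k' b')

variable {P} in
/-- The distance of the two averages along `S` that belong to the `k`-th pair. -/
noncomputable def jump (S : Finset (Γ → koopmanGroup P)) (f : (Γ → koopmanGroup P) → unitBall P)
    (Φ : ℕ → Bool → Set Γ) (a : ℕ → Bool → Γ) (k : ℕ) : ℝ :=
  ‖systemAverage μ S f (a k true • Φ k true) - systemAverage μ S f (a k false • Φ k false)‖

/-- For systems of complexity at most `c`, the jumps are small on average, and this is uniform in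
the system, in the functions and in the sets. As the bound is uniform, it is inherited by averages
of averages. -/
def HasAverageBound [TopologicalSpace Γ] (c : ℕ) : Prop :=
  ∀ ε : ℝ, 0 < ε → ∃ γ : ℝ≥0, 0 < γ ∧ ∃ K : ℕ, 0 < K ∧ ∀ (Φ : ℕ → Bool → Set Γ)
    (a : ℕ → Bool → Γ), IsSeparated μ γ Φ a → ∀ S : Finset (Γ → koopmanGroup P), 1 ∈ S →
    ComplexityLE c S → (∀ h ∈ S, IsMeasurableMap μ h) →
    ∀ f : (Γ → koopmanGroup P) → unitBall P,
      ∑ k ∈ Finset.range K, jump μ S f Φ a k ≤ ε * K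

/-- For systems of complexity at most `c`, at least one of the first `K` jumps is small, with the
same uniformity as in `HasAverageBound`. -/
def HasJumpBound [TopologicalSpace Γ] (c : ℕ) : Prop :=
  ∀ ε : ℝ, 0 < ε → ∃ γ : ℝ≥0, 0 < γ ∧ ∃ K : ℕ, 0 < K ∧ ∀ (Φ : ℕ → Bool → Set Γ)
    (a : ℕ → Bool → Γ), IsSeparated μ γ Φ a → ∀ S : Finset (Γ → koopmanGroup P), 1 ∈ S →
    ComplexityLE c S → (∀ h ∈ S, IsMeasurableMap μ h) →
    ∀ f : (Γ → koopmanGroup P) → unitBall P, ∃ k < K, jump μ S f Φ a k ≤ ε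

variable {μ P}

section Basic

variable [TopologicalSpace Γ]

theorem IsSeparated.comp {γ : ℝ≥0} {Φ : ℕ → Bool → Set Γ} {a : ℕ → Bool → Γ}
    (h : IsSeparated μ γ Φ a) {e : ℕ → ℕ} (he : StrictMono e) :
    IsSeparated μ γ (fun k => Φ (e k)) (fun k => a (e k)) :=
  ⟨fun k => h.isCompact (e k), fun k => h.measure_ne_zero (e k),
    fun _ _ hk => h.almost_invariant _ _ (he hk)⟩

theorem IsSeparated.mono {γ γ' : ℝ≥0} {Φ : ℕ → Bool → Set Γ} {a : ℕ → Bool → Γ}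
    (h : IsSeparated μ γ Φ a) (hγ : γ ≤ γ') : IsSeparated μ γ' Φ a :=
  ⟨h.isCompact, h.measure_ne_zero, fun k k' hk b b' m hm =>
    (h.almost_invariant k k' hk b b' m hm).trans (mul_le_mul_left (by exact_mod_cast hγ) _)⟩

variable [IsTopologicalGroup Γ] [μ.IsHaarMeasure]

omit [μ.IsHaarMeasure] in
theorem IsSeparated.isCompact_smul {γ : ℝ≥0} {Φ : ℕ → Bool → Set Γ} {a : ℕ → Bool → Γ}
    (h : IsSeparated μ γ Φ a) (k : ℕ) (b : Bool) : IsCompact (a k b • Φ k b) :=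
  (h.isCompact k b).smul _

omit [IsTopologicalGroup Γ] in
theorem IsSeparated.measure_smul_ne_zero {γ : ℝ≥0} {Φ : ℕ → Bool → Set Γ} {a : ℕ → Bool → Γ}
    (h : IsSeparated μ γ Φ a) (k : ℕ) (b : Bool) : μ (a k b • Φ k b) ≠ 0 := by
  rw [measure_smul]
  exact h.measure_ne_zero k b

theorem jump_le_two {γ : ℝ≥0} {Φ : ℕ → Bool → Set Γ} {a : ℕ → Bool → Γ}
    (h : IsSeparated μ γ Φ a) (S : Finset (Γ → koopmanGroup P))
    (f : (Γ → koopmanGroup P) → unitBall P) (k : ℕ) : jump μ S f Φ a k ≤ 2 := by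
  refine (norm_sub_le _ _).trans ?_
  have h1 := norm_systemAverage_le S f (h.isCompact_smul k true) (h.measure_smul_ne_zero k true)
  have h2 := norm_systemAverage_le S f (h.isCompact_smul k false) (h.measure_smul_ne_zero k false)
  linarith

theorem jump_eq_zero_of_subset {γ : ℝ≥0} {Φ : ℕ → Bool → Set Γ} {a : ℕ → Bool → Γ}
    (h : IsSeparated μ γ Φ a) {S : Finset (Γ → koopmanGroup P)} (hS : S ⊆ {1})
    (f : (Γ → koopmanGroup P) → unitBall P) (k : ℕ) : jump μ S f Φ a k = 0 := by
  have key : ∀ b, systemAverage μ S f (a k b • Φ k b) = toL2 (∏ h ∈ S, f h) := by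
    intro b
    have := ProbabilityTheory.cond_isProbabilityMeasure_of_finite (h.measure_smul_ne_zero k b)
      (h.isCompact_smul k b).measure_lt_top.ne
    have e : ∀ m, toL2 (systemProduct S f m) = toL2 (∏ h ∈ S, f h) := fun m => by
      rw [systemProduct]
      refine congrArg toL2 (Finset.prod_congr rfl fun g hg => ?_)
      rw [Finset.mem_singleton.1 (hS hg), Pi.one_apply, one_smul]
    simp only [systemAverage, e, integral_const, probReal_univ, one_smul]
  rw [jump, key, key, sub_self, norm_zero]

theorem hasAverageBound_zero : HasAverageBound μ P 0 := fun ε hε =>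
  ⟨1, one_pos, 1, one_pos, fun Φ a hΦ S _ hc _ f => by
    rw [Finset.sum_congr rfl fun k _ => jump_eq_zero_of_subset hΦ hc f k]
    simpa using hε.le⟩

/-- If among any `K` pairs there is one with a small jump, then fewer than `K` jumps are not small,
and the average of a long sequence of jumps is small. -/
theorem HasJumpBound.hasAverageBound {c : ℕ} (hc : HasJumpBound μ P c) :
    HasAverageBound μ P c := by
  classical
  intro ε hε
  obtain ⟨γ, hγ, K, hK, H⟩ := hc (ε / 2) (half_pos hε)
  obtain ⟨K', hK'⟩ := exists_nat_gt (4 * K / ε)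
  have hK'0 : (0 : ℝ) < K' := lt_of_le_of_lt (by positivity) hK'
  refine ⟨γ, hγ, K', by exact_mod_cast hK'0, fun Φ a hΦ S h1 hS hm f => ?_⟩
  set B := (Finset.range K').filter (fun k => ε / 2 < jump μ S f Φ a k) with hB
  have hcard : B.card < K := by
    by_contra hcon
    -- The indices of the large jumps, continued by all the indices from `K'` on.
    set p : ℕ → Prop := fun k => K' ≤ k ∨ ε / 2 < jump μ S f Φ a k
    have hinf : {k | p k}.Infinite := (Set.Ici_infinite K').mono fun k hk => Or.inl hk
    obtain ⟨k, hk, hkj⟩ := H _ _ (hΦ.comp (Nat.nth_strictMono hinf)) S h1 hS hm f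
    have hcount : k < Nat.count p K' := by
      rw [Nat.count_eq_card_filter_range]
      refine lt_of_lt_of_le (hk.trans_le (not_lt.1 hcon)) (Finset.card_le_card fun i hi => ?_)
      rw [hB, Finset.mem_filter] at hi
      exact Finset.mem_filter.2 ⟨hi.1, Or.inr hi.2⟩
    rcases Nat.nth_mem_of_infinite hinf k with h | h
    · exact absurd (Nat.nth_lt_of_lt_count hcount) (not_lt.2 h)
    · exact absurd hkj (not_le.2 h)
  have hsum : ∀ k ∈ Finset.range K', jump μ S f Φ a k ≤ (if k ∈ B then 2 else 0) + ε / 2 := by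
    intro k hk
    split_ifs with hkB
    · linarith [jump_le_two hΦ S f k]
    · have : ¬ ε / 2 < jump μ S f Φ a k := fun h => hkB (Finset.mem_filter.2 ⟨hk, h⟩)
      linarith
  refine (Finset.sum_le_sum hsum).trans ?_
  rw [Finset.sum_add_distrib, Finset.sum_const, Finset.card_range, Finset.sum_ite_mem,
    Finset.inter_eq_right.2 (Finset.filter_subset _ _), Finset.sum_const, nsmul_eq_mul,
    nsmul_eq_mul]
  have h1 : (B.card : ℝ) ≤ K := by exact_mod_cast hcard.le
  rw [div_lt_iff₀ hε] at hK'
  linarith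

end Basic

section Step

variable [TopologicalSpace Γ] [IsTopologicalGroup Γ] [LocallyCompactSpace Γ]
  [T2Space Γ] [BorelSpace Γ] [μ.IsHaarMeasure] [μ.Regular]

variable (μ) in
/-- The distance of the two averages of the `k`-th pair, with `u` in the place of `f_g`. -/
noncomputable def slotJump (S : Finset (Γ → koopmanGroup P)) (g : Γ → koopmanGroup P)
    (f : (Γ → koopmanGroup P) → unitBall P) (Φ : ℕ → Bool → Set Γ) (a : ℕ → Bool → Γ)
    (u : Lp ℂ 2 P) (k : ℕ) : ℝ :=
  ‖slotAverage μ S g f (a k true • Φ k true) u - slotAverage μ S g f (a k false • Φ k false) u‖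

variable {S : Finset (Γ → koopmanGroup P)} {g : Γ → koopmanGroup P}
  {f : (Γ → koopmanGroup P) → unitBall P} {Φ : ℕ → Bool → Set Γ} {a : ℕ → Bool → Γ}

omit [LocallyCompactSpace Γ] [T2Space Γ] [BorelSpace Γ] [μ.Regular] in
theorem slotJump_add_smul_le {γ : ℝ≥0} (hΦ : IsSeparated μ γ Φ a)
    (hS : ∀ h ∈ S, IsMeasurableMap μ h) (hg : g ∈ S) (u v : Lp ℂ 2 P) {c : ℂ} (hc : ‖c‖ ≤ 1)
    (k : ℕ) : slotJump μ S g f Φ a (u + c • v) k ≤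
      slotJump μ S g f Φ a u k + slotJump μ S g f Φ a v k := by
  have e := fun b => slotAverage_add_smul (f := f) hS hg (hΦ.isCompact_smul k b)
    (hΦ.measure_smul_ne_zero k b) u v c
  rw [slotJump, e, e, add_sub_add_comm, ← smul_sub]
  refine (norm_add_le _ _).trans (add_le_add_right ?_ _)
  rw [norm_smul]
  exact mul_le_of_le_one_left (norm_nonneg _) hc

/-- The structured function that belongs to a set in the pair `k'`, when put in the place of `f_g`,
has small jumps on average over a block of earlier pairs. This is where the bound for systems of
lower complexity is used. -/
theorem sum_slotJump_structured_le {γ : ℝ≥0} {ε : ℝ} {n K : ℕ}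
    (H : ∀ (Φ : ℕ → Bool → Set Γ) (a : ℕ → Bool → Γ), IsSeparated μ γ Φ a →
      ∀ S : Finset (Γ → koopmanGroup P), 1 ∈ S → ComplexityLE n S →
      (∀ h ∈ S, IsMeasurableMap μ h) → ∀ f : (Γ → koopmanGroup P) → unitBall P,
      ∑ k ∈ Finset.range K, jump μ S f Φ a k ≤ ε * K)
    (hΦ : IsSeparated μ γ Φ a) (h1 : 1 ∈ S) (hS : ∀ h ∈ S, IsMeasurableMap μ h) (hg : g ∈ S)
    (hg1 : g ≠ 1) (hred : ∀ a b, ComplexityLE n (reducedSystem S g a b)) (c : unitBall P)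
    {o k' : ℕ} (hk' : o + K ≤ k') (b' : Bool) :
    ∑ k ∈ Finset.range K, slotJump μ S g f Φ a (structured μ S g f c (a k' b') (Φ k' b')) (o + k) ≤
      (2 * γ + ε) * K := by
  classical
  set ν := ProbabilityTheory.cond μ (Φ k' b') with hν
  set a' := a k' b'
  have hprob : IsProbabilityMeasure ν := ProbabilityTheory.cond_isProbabilityMeasure_of_finite
    (hΦ.measure_ne_zero k' b') (hΦ.isCompact k' b').measure_lt_top.ne
  -- The averages along the reduced systems with parameter `n ∈ Φ`.
  set A : ℕ → Bool → Γ → Lp ℂ 2 P := fun k b n =>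
    ∫ m, toL2 (structuredSlot S g f c a' (m, n)) ∂(ProbabilityTheory.cond μ (a k b • Φ k b))
    with hA
  have hAint : ∀ k b, Integrable (A k b) ν := by
    intro k b
    have := ProbabilityTheory.cond_isProbabilityMeasure_of_finite (hΦ.measure_smul_ne_zero k b)
      (hΦ.isCompact_smul k b).measure_lt_top.ne
    exact (integrable_structuredSlot hS hg c a' (hΦ.isCompact_smul k b)
      (hΦ.measure_smul_ne_zero k b) (hΦ.isCompact k' b')
      (hΦ.measure_ne_zero k' b')).integral_prod_right
  have hclose : ∀ k < k', ∀ b, ‖slotAverage μ S g f (a k b • Φ k b)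
      (structured μ S g f c a' (Φ k' b')) - ∫ n, A k b n ∂ν‖ ≤ γ := fun k hk b =>
    norm_slotAverage_structured_sub_le hS hg c a' (hΦ.isCompact_smul k b)
      (hΦ.measure_smul_ne_zero k b) (hΦ.isCompact k' b') (hΦ.measure_ne_zero k' b')
      (hΦ.almost_invariant k k' hk b b')
  have hjump : ∀ k < k', slotJump μ S g f Φ a (structured μ S g f c a' (Φ k' b')) k ≤
      2 * γ + ∫ n, ‖A k true n - A k false n‖ ∂ν := by
    intro k hk
    have h3 : ‖(∫ n, A k true n ∂ν) - ∫ n, A k false n ∂ν‖ ≤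
        ∫ n, ‖A k true n - A k false n‖ ∂ν := by
      rw [← integral_sub (hAint k true) (hAint k false)]
      exact norm_integral_le_integral_norm _
    have h4 := hclose k hk true
    have h5 := hclose k hk false
    rw [norm_sub_rev] at h5
    have h6 := norm_add₃_le (a := slotAverage μ S g f (a k true • Φ k true)
        (structured μ S g f c a' (Φ k' b')) - ∫ n, A k true n ∂ν)
      (b := (∫ n, A k true n ∂ν) - ∫ n, A k false n ∂ν)
      (c := (∫ n, A k false n ∂ν) - slotAverage μ S g f (a k false • Φ k false)
        (structured μ S g f c a' (Φ k' b')))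
    rw [sub_add_sub_cancel, sub_add_sub_cancel] at h6
    refine h6.trans ?_
    linarith
  have hpoint : ∀ n, ∑ k ∈ Finset.range K, ‖A (o + k) true n - A (o + k) false n‖ ≤ ε * K := by
    intro n
    obtain ⟨F, hF⟩ := exists_systemProduct_reducedSystem h1 hg1 f (fun h => star (f h)) c a' n
    have hsep := hΦ.comp (e := fun k => o + k) (fun _ _ h => Nat.add_lt_add_left h o)
    have := H _ _ hsep _ (one_mem_reducedSystem h1 hg1 a' n) (hred a' n)
      (isMeasurableMap_reducedSystem hS hg a' n) F
    refine le_of_eq_of_le (Finset.sum_congr rfl fun k _ => ?_) this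
    simp only [jump, systemAverage, hF, hA, structuredSlot]
  calc ∑ k ∈ Finset.range K,
        slotJump μ S g f Φ a (structured μ S g f c a' (Φ k' b')) (o + k)
      ≤ ∑ k ∈ Finset.range K,
        (2 * (γ : ℝ) + ∫ n, ‖A (o + k) true n - A (o + k) false n‖ ∂ν) :=
        Finset.sum_le_sum fun k hk => hjump (o + k) (by have := Finset.mem_range.1 hk; omega)
    _ = K * (2 * γ) + ∫ n, ∑ k ∈ Finset.range K, ‖A (o + k) true n - A (o + k) false n‖ ∂ν := by
        have hsum : ∫ n, ∑ k ∈ Finset.range K, ‖A (o + k) true n - A (o + k) false n‖ ∂ν =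
            ∑ k ∈ Finset.range K, ∫ n, ‖A (o + k) true n - A (o + k) false n‖ ∂ν :=
          integral_finsetSum _ fun k _ => ((hAint (o + k) true).sub (hAint (o + k) false)).norm
        rw [Finset.sum_add_distrib, Finset.sum_const, Finset.card_range, nsmul_eq_mul, hsum]
    _ ≤ K * (2 * γ) + ε * K := by
        refine add_le_add_right ((Real.le_norm_self _).trans (norm_integral_le_of_prob ν
          (Eventually.of_forall fun n => ?_))) _
        rw [Real.norm_of_nonneg (Finset.sum_nonneg fun _ _ => norm_nonneg _)]
        exact hpoint n
    _ = (2 * γ + ε) * K := by ring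

omit [LocallyCompactSpace Γ] [T2Space Γ] [BorelSpace Γ] [μ.Regular] in
/-- Averages with a large jump are detected by a bounded function. -/
theorem exists_lt_inner_of_lt_jump {γ : ℝ≥0} (hΦ : IsSeparated μ γ Φ a)
    (hS : ∀ h ∈ S, IsMeasurableMap μ h) (f : (Γ → koopmanGroup P) → unitBall P) {ε : ℝ}
    (hε : 0 < ε) {k : ℕ} (hk : ε < jump μ S f Φ a k) :
    ∃ c : unitBall P, ε ^ 2 / 2 < ‖⟪toL2 c, systemAverage μ S f (a k true • Φ k true) -
      systemAverage μ S f (a k false • Φ k false)⟫_ℂ‖ := by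
  obtain ⟨c, hc⟩ := exists_toL2_eq_half_sub
    (systemAverage_norm_le_one hS f (hΦ.isCompact_smul k true) (hΦ.measure_smul_ne_zero k true))
    (systemAverage_norm_le_one hS f (hΦ.isCompact_smul k false) (hΦ.measure_smul_ne_zero k false))
  refine ⟨c, ?_⟩
  set w := systemAverage μ S f (a k true • Φ k true) -
    systemAverage μ S f (a k false • Φ k false) with hw
  have h2 : toL2 c = ((1 / 2 : ℝ) : ℂ) • w := by
    rw [hc, two_smul, ← two_smul ℂ, smul_smul]
    norm_num
  have h3 : ε ^ 2 < ‖w‖ ^ 2 := by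
    have : ε < ‖w‖ := hk
    gcongr
  rw [h2, inner_smul_left, norm_mul, inner_self_eq_norm_sq_to_K]
  simp only [Complex.conj_ofReal, Complex.norm_real, norm_pow]
  simp
  linarith

/-- The inductive step. If all the jumps of the averages along `S` are large, then structured
functions are split off from `f_g` repeatedly, in earlier and earlier blocks of pairs, until the
energy of `f_g` is exhausted. -/
theorem HasAverageBound.hasJumpBound_succ {n : ℕ} (hn : HasAverageBound μ P n) :
    HasJumpBound μ P (n + 1) := by
  intro ε hε
  -- `δ` is the least correlation that is split off, and this can happen at most `T` times.
  set δ : ℝ := ε ^ 2 / 8 with hδ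
  have hδ0 : 0 < δ := by positivity
  obtain ⟨T, hT⟩ := exists_nat_gt (1 / δ ^ 2)
  have hT0 : (0 : ℝ) < T := lt_trans (by positivity) hT
  set η : ℝ := ε ^ 2 / (16 * T) with hη
  have hη0 : 0 < η := by positivity
  obtain ⟨γ₁, hγ₁, K, hK, H⟩ := hn η hη0
  have hK0 : (0 : ℝ) < K := by exact_mod_cast hK
  set γ : ℝ≥0 := min γ₁ ⟨η, hη0.le⟩ with hγ
  have hγη : (γ : ℝ) ≤ η := by exact_mod_cast (min_le_right γ₁ ⟨η, hη0.le⟩ : γ ≤ ⟨η, hη0.le⟩)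
  refine ⟨γ, lt_min hγ₁ (by exact_mod_cast hη0), T * K, Nat.mul_pos (by exact_mod_cast hT0) hK,
    fun Φ a hΦ S h1 hS hm f => ?_⟩
  have H' := fun Φ a (hΦ : IsSeparated μ γ Φ a) => H Φ a (hΦ.mono (min_le_left _ _))
  rcases hS with hS | ⟨g, hg, hg1, hred⟩
  · exact ⟨0, Nat.mul_pos (by exact_mod_cast hT0) hK,
      (jump_eq_zero_of_subset hΦ hS f 0).trans_le hε.le⟩
  by_contra hcon
  push Not at hcon
  -- After `t` steps, the remainder `u` has lost `t δ²` of its energy, and what has been split off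
  -- has small jumps on average in each of the remaining blocks.
  have greedy : ∀ t ≤ T, ∃ u : Lp ℂ 2 P, ‖u‖ ^ 2 ≤ 1 - t * δ ^ 2 ∧
      ∀ o, o + K ≤ (T - t) * K → ∑ k ∈ Finset.range K,
        slotJump μ S g f Φ a (toL2 (f g) - u) (o + k) ≤ t * (3 * η) * K := by
    intro t
    induction t with
    | zero =>
      refine fun _ => ⟨toL2 (f g), ?_, fun o _ => ?_⟩
      · have := norm_toL2_le (f g)
        simpa using (pow_le_one₀ (norm_nonneg _) this : ‖toL2 (f g)‖ ^ 2 ≤ 1)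
      · have : ∀ k, slotJump μ S g f Φ a (toL2 (f g) - toL2 (f g)) k = 0 := fun k => by
          simp [slotJump, slotAverage]
        rw [Finset.sum_congr rfl fun k _ => this (o + k)]
        simp
    | succ t ih =>
      intro ht
      obtain ⟨u, hu, hlow⟩ := ih (by omega)
      obtain ⟨r, hr⟩ : ∃ r, T - t = r + 1 := ⟨T - t - 1, by omega⟩
      have hr' : T - (t + 1) = r := by omega
      have hrK : r * K + K = (T - t) * K := by rw [hr]; ring
      -- In the block `[rK, (r + 1)K)`, some jump of the structured part is small.
      have hsmall : ∃ k < K, slotJump μ S g f Φ a (toL2 (f g) - u) (r * K + k) ≤ ε ^ 2 / 4 := by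
        by_contra hbig
        push Not at hbig
        have hb := hlow (r * K) hrK.le
        have hlt : ∑ k ∈ Finset.range K, ε ^ 2 / 4 < ∑ k ∈ Finset.range K,
            slotJump μ S g f Φ a (toL2 (f g) - u) (r * K + k) :=
          Finset.sum_lt_sum_of_nonempty ⟨0, Finset.mem_range.2 hK⟩
            fun k hk => hbig k (Finset.mem_range.1 hk)
        rw [Finset.sum_const, Finset.card_range, nsmul_eq_mul] at hlt
        have htT : (t : ℝ) ≤ T := by exact_mod_cast (by omega : t ≤ T)
        have h3 : (t : ℝ) * (3 * η) ≤ ε ^ 2 / 4 := by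
          calc (t : ℝ) * (3 * η) ≤ T * (3 * η) := by gcongr
            _ = 3 * ε ^ 2 / 16 := by rw [hη]; field_simp
            _ ≤ ε ^ 2 / 4 := by nlinarith [sq_nonneg ε]
        have h4 : (t : ℝ) * (3 * η) * K ≤ K * (ε ^ 2 / 4) := by
          rw [mul_comm (K : ℝ)]; gcongr
        linarith
      obtain ⟨k₀, hk₀, hk₀j⟩ := hsmall
      set k := r * K + k₀ with hk
      have hkT : k < T * K := by
        have : (T - t) * K ≤ T * K := Nat.mul_le_mul_right _ (Nat.sub_le _ _)
        omega
      obtain ⟨c, hc⟩ := exists_lt_inner_of_lt_jump hΦ hm f hε (hcon k hkT)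
      -- Hence the averages of the remainder are detected by `c`.
      have hsplit : ∀ b, systemAverage μ S f (a k b • Φ k b) =
          slotAverage μ S g f (a k b • Φ k b) (toL2 (f g) - u) +
            slotAverage μ S g f (a k b • Φ k b) u := by
        intro b
        have := slotAverage_add_smul (f := f) hm hg (hΦ.isCompact_smul k b)
          (hΦ.measure_smul_ne_zero k b) (toL2 (f g) - u) u 1
        rw [one_smul, one_smul, sub_add_cancel] at this
        rw [systemAverage_eq_slotAverage μ hg, this]
      have hdet : ∃ b, δ < ‖⟪toL2 c, slotAverage μ S g f (a k b • Φ k b) u⟫_ℂ‖ := by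
        by_contra hno
        push Not at hno
        rw [hsplit, hsplit, add_sub_add_comm, inner_add_right,
          inner_sub_right (toL2 c) (slotAverage μ S g f (a k true • Φ k true) u)] at hc
        have b1 : ‖⟪toL2 c, slotAverage μ S g f (a k true • Φ k true) (toL2 (f g) - u) -
            slotAverage μ S g f (a k false • Φ k false) (toL2 (f g) - u)⟫_ℂ‖ ≤ ε ^ 2 / 4 := by
          refine (norm_inner_le_norm _ _).trans ?_
          refine (mul_le_of_le_one_left (norm_nonneg _) (norm_toL2_le c)).trans hk₀j
        have b2 := hno true
        have b3 := hno false
        have b4 := (norm_add_le (⟪toL2 c, slotAverage μ S g f (a k true • Φ k true)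
          (toL2 (f g) - u) - slotAverage μ S g f (a k false • Φ k false)
          (toL2 (f g) - u)⟫_ℂ) _).trans (add_le_add_right (norm_sub_le
            ⟪toL2 c, slotAverage μ S g f (a k true • Φ k true) u⟫_ℂ
            ⟪toL2 c, slotAverage μ S g f (a k false • Φ k false) u⟫_ℂ) _)
        rw [hδ] at b2 b3
        linarith
      obtain ⟨b, hb⟩ := hdet
      rw [inner_slotAverage hm hg c _ (hΦ.isCompact k b) (hΦ.measure_ne_zero k b)] at hb
      set σ := structured μ S g f c (a k b) (Φ k b) with hσ
      have hσ1 : ‖σ‖ ≤ 1 := norm_structured_le S g f c _ (hΦ.isCompact k b)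
        (hΦ.measure_ne_zero k b)
      have hu1 : ‖u‖ ≤ 1 := by
        have : ‖u‖ ^ 2 ≤ 1 := hu.trans (sub_le_self _ (by positivity))
        exact (sq_le_one_iff₀ (norm_nonneg _)).1 this
      set z : ℂ := ⟪σ, u⟫_ℂ with hz
      have hz1 : ‖z‖ ≤ 1 := (norm_inner_le_norm _ _).trans
        (mul_le_one₀ hσ1 (norm_nonneg _) hu1)
      refine ⟨u - z • σ, ?_, fun o ho => ?_⟩
      · have h5 : ‖u - z • σ‖ ^ 2 ≤ ‖u‖ ^ 2 - ‖z‖ ^ 2 := by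
          rw [norm_sub_sq (𝕜 := ℂ), inner_smul_right, ← inner_conj_symm, ← hz, norm_smul,
            RCLike.mul_conj, mul_pow]
          have h6 : ‖z‖ ^ 2 * ‖σ‖ ^ 2 ≤ ‖z‖ ^ 2 := mul_le_of_le_one_right (sq_nonneg _)
            (pow_le_one₀ (norm_nonneg _) hσ1)
          have h7 : RCLike.re (((‖z‖ : ℝ) : ℂ) ^ 2) = ‖z‖ ^ 2 := by
            rw [← Complex.ofReal_pow]; exact Complex.ofReal_re _
          have h8 : RCLike.re ((RCLike.ofReal ‖z‖ : ℂ) ^ 2) = ‖z‖ ^ 2 := h7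
          rw [h8]
          linarith
        have h9 : δ ^ 2 ≤ ‖z‖ ^ 2 := by gcongr
        push_cast
        linarith
      · rw [hr'] at ho
        have e : toL2 (f g) - (u - z • σ) = (toL2 (f g) - u) + z • σ := by abel
        have hstr := sum_slotJump_structured_le (f := f) (K := K) H' hΦ h1 hm hg hg1 hred c
          (o := o) (k' := k) (by omega) b
        rw [← hσ] at hstr
        calc ∑ i ∈ Finset.range K, slotJump μ S g f Φ a (toL2 (f g) - (u - z • σ)) (o + i)
            ≤ ∑ i ∈ Finset.range K, (slotJump μ S g f Φ a (toL2 (f g) - u) (o + i) +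
                slotJump μ S g f Φ a σ (o + i)) := by
              rw [e]
              exact Finset.sum_le_sum fun i _ => slotJump_add_smul_le hΦ hm hg _ _ hz1 _
          _ ≤ t * (3 * η) * K + (2 * γ + η) * K := by
              rw [Finset.sum_add_distrib]
              exact add_le_add (hlow o (ho.trans (by omega))) hstr
          _ ≤ t * (3 * η) * K + (3 * η) * K := by gcongr; linarith
          _ = ((t + 1 : ℕ) : ℝ) * (3 * η) * K := by push_cast; ring
  obtain ⟨u, hu, -⟩ := greedy T le_rfl
  have h10 : 1 < T * δ ^ 2 := by rwa [div_lt_iff₀ (by positivity)] at hT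
  linarith [sq_nonneg ‖u‖]

theorem hasAverageBound (n : ℕ) : HasAverageBound μ P n := by
  induction n with
  | zero => exact hasAverageBound_zero
  | succ n ih => exact ih.hasJumpBound_succ.hasAverageBound

end Step

end AverageBound

/-! ### Comparison of two Følner nets -/

section Folner

open scoped NNReal

variable {Γ : Type*} [Group Γ] [TopologicalSpace Γ] [MeasurableSpace Γ] {μ : Measure Γ}

theorem IsFolnerNet.exists_forall_measure_symmDiff_le [BorelSpace Γ] [IsFiniteMeasureOnCompacts μ]
    {A : Type*} [Preorder A] [IsDirectedOrder A] [Nonempty A] {Φ : A → Set Γ}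
    (hΦ : IsFolnerNet μ Φ) {γ : ℝ≥0} (hγ : 0 < γ) {K : Set Γ} (hK : IsCompact K) :
    ∃ α₀, ∀ α, α₀ ≤ α → ∀ l ∈ K, μ ((l • Φ α) ∆ Φ α) ≤ γ * μ (Φ α) := by
  obtain ⟨α₀, h⟩ := eventually_atTop.1 ((hΦ.tendsto K hK).eventually_le_const
    (ENNReal.coe_pos.2 hγ))
  refine ⟨α₀, fun α hα l hl => ?_⟩
  have h1 : μ ((l • Φ α) ∆ Φ α) / μ (Φ α) ≤ γ := (le_iSup₂ (f := fun l (_ : l ∈ K) =>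
    μ ((l • Φ α) ∆ Φ α) / μ (Φ α)) l hl).trans (h α hα)
  exact (ENNReal.div_le_iff (hΦ.measure_ne_zero α) (hΦ.isCompact α).measure_lt_top.ne).1 h1

variable [IsTopologicalGroup Γ] [LocallyCompactSpace Γ] [T2Space Γ] [BorelSpace Γ]
  [μ.IsHaarMeasure] [μ.Regular]
  {X : Type*} [MeasurableSpace X] {P : Measure X} [IsProbabilityMeasure P]

/-- Averages along two Følner nets get close to each other. If not, a sequence of pairs of sets
with large jumps could be selected, each far beyond its predecessors. -/
theorem exists_forall_norm_systemAverage_sub_le {A B : Type*} [Preorder A] [IsDirectedOrder A]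
    [Nonempty A] [Preorder B] [IsDirectedOrder B] [Nonempty B] {Φ : A → Set Γ} {Ψ : B → Set Γ}
    (hΦ : IsFolnerNet μ Φ) (hΨ : IsFolnerNet μ Ψ) (a : A → Γ) (b : B → Γ)
    {S : Finset (Γ → koopmanGroup P)} (h1 : 1 ∈ S) {n : ℕ} (hn : ComplexityLE n S)
    (hS : ∀ h ∈ S, IsMeasurableMap μ h) (f : (Γ → koopmanGroup P) → unitBall P)
    {ε : ℝ} (hε : 0 < ε) :
    ∃ α₀ β₀, ∀ α, α₀ ≤ α → ∀ β, β₀ ≤ β →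
      ‖systemAverage μ S f (a α • Φ α) - systemAverage μ S f (b β • Ψ β)‖ ≤ ε := by
  by_contra hcon
  push Not at hcon
  obtain ⟨γ, hγ, K, hK, H⟩ := hasAverageBound (μ := μ) (P := P) n ε hε
  have hstep : ∀ C : Set Γ, IsCompact C → ∃ p : A × B,
      (∀ l ∈ C, μ ((l • Φ p.1) ∆ Φ p.1) ≤ γ * μ (Φ p.1)) ∧
      (∀ l ∈ C, μ ((l • Ψ p.2) ∆ Ψ p.2) ≤ γ * μ (Ψ p.2)) ∧
      ε < ‖systemAverage μ S f (a p.1 • Φ p.1) - systemAverage μ S f (b p.2 • Ψ p.2)‖ := by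
    intro C hC
    obtain ⟨α₀, hα₀⟩ := hΦ.exists_forall_measure_symmDiff_le hγ hC
    obtain ⟨β₀, hβ₀⟩ := hΨ.exists_forall_measure_symmDiff_le hγ hC
    obtain ⟨α, hα, β, hβ, hlt⟩ := hcon α₀ β₀
    exact ⟨(α, β), hα₀ α hα, hβ₀ β hβ, hlt⟩
  choose p hpΦ hpΨ hpε using hstep
  -- `C k` is the union of all the translates that belong to the first `k` pairs.
  let C : ℕ → {C : Set Γ // IsCompact C} := fun k => Nat.rec ⟨∅, isCompact_empty⟩
    (fun _ C => ⟨C.1 ∪ (a (p C.1 C.2).1 • Φ (p C.1 C.2).1 ∪ b (p C.1 C.2).2 • Ψ (p C.1 C.2).2),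
      C.2.union (((hΦ.isCompact _).smul _).union ((hΨ.isCompact _).smul _))⟩) k
  let q : ℕ → A × B := fun k => p (C k).1 (C k).2
  have hC : ∀ k, (C (k + 1)).1 = (C k).1 ∪ (a (q k).1 • Φ (q k).1 ∪ b (q k).2 • Ψ (q k).2) :=
    fun _ => rfl
  have hCmono : Monotone fun k => (C k).1 :=
    monotone_nat_of_le_succ fun k => (hC k).symm ▸ Set.subset_union_left
  let Θ : ℕ → Bool → Set Γ := fun k t => bif t then Φ (q k).1 else Ψ (q k).2
  let c : ℕ → Bool → Γ := fun k t => bif t then a (q k).1 else b (q k).2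
  have hsub : ∀ k k', k < k' → ∀ t, c k t • Θ k t ⊆ (C k').1 := by
    intro k k' hk t
    refine Set.Subset.trans ?_ (hCmono (Nat.succ_le_of_lt hk))
    change _ ⊆ (C (k + 1)).1
    rw [hC]
    refine Set.Subset.trans ?_ Set.subset_union_right
    cases t
    · exact Set.subset_union_right
    · exact Set.subset_union_left
  have hsep : IsSeparated μ γ Θ c := by
    refine ⟨fun k t => ?_, fun k t => ?_, fun k k' hk t t' m hm => ?_⟩
    · cases t
      exacts [hΨ.isCompact _, hΦ.isCompact _]
    · cases t
      exacts [hΨ.measure_ne_zero _, hΦ.measure_ne_zero _]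
    · have hm' := hsub k k' hk t hm
      cases t'
      exacts [hpΨ _ _ m hm', hpΦ _ _ m hm']
  have hlt : ∑ k ∈ Finset.range K, ε < ∑ k ∈ Finset.range K, jump μ S f Θ c k :=
    Finset.sum_lt_sum_of_nonempty ⟨0, Finset.mem_range.2 hK⟩ fun k _ => hpε _ _
  rw [Finset.sum_const, Finset.card_range, nsmul_eq_mul] at hlt
  linarith [H Θ c hsep S h1 hn hS f]

theorem exists_tendsto_systemAverage_of_isFolnerNet {A : Type*} [Preorder A] [IsDirectedOrder A]
    [Nonempty A] {Φ : A → Set Γ} (hΦ : IsFolnerNet μ Φ) (a : A → Γ)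
    {S : Finset (Γ → koopmanGroup P)} (h1 : 1 ∈ S) {n : ℕ} (hn : ComplexityLE n S)
    (hS : ∀ h ∈ S, IsMeasurableMap μ h) (f : (Γ → koopmanGroup P) → unitBall P) :
    ∃ L, Tendsto (fun α => systemAverage μ S f (a α • Φ α)) atTop (𝓝 L) := by
  refine cauchy_map_iff_exists_tendsto.1 (Metric.cauchy_iff.2 ⟨inferInstance, fun ε hε => ?_⟩)
  obtain ⟨α₀, β₀, h⟩ := exists_forall_norm_systemAverage_sub_le hΦ hΦ a a h1 hn hS f (half_pos hε)
  obtain ⟨δ, hδ1, hδ2⟩ := exists_ge_ge α₀ β₀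
  refine ⟨_, image_mem_map (Ici_mem_atTop δ), ?_⟩
  rintro _ ⟨α, hα, rfl⟩ _ ⟨β, hβ, rfl⟩
  rw [dist_eq_norm]
  exact (h α (hδ1.trans hα) β (hδ2.trans hβ)).trans_lt (half_lt_self hε)

theorem tendsto_systemAverage_of_tendsto {A B : Type*} [Preorder A] [IsDirectedOrder A]
    [Nonempty A] [Preorder B] [IsDirectedOrder B] [Nonempty B] {Φ : A → Set Γ} {Ψ : B → Set Γ}
    (hΦ : IsFolnerNet μ Φ) (hΨ : IsFolnerNet μ Ψ) (a : A → Γ) (b : B → Γ)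
    {S : Finset (Γ → koopmanGroup P)} (h1 : 1 ∈ S) {n : ℕ} (hn : ComplexityLE n S)
    (hS : ∀ h ∈ S, IsMeasurableMap μ h) (f : (Γ → koopmanGroup P) → unitBall P) {L : Lp ℂ 2 P}
    (hL : Tendsto (fun α => systemAverage μ S f (a α • Φ α)) atTop (𝓝 L)) :
    Tendsto (fun β => systemAverage μ S f (b β • Ψ β)) atTop (𝓝 L) := by
  refine Metric.tendsto_nhds.2 fun ε hε => ?_
  obtain ⟨α₀, β₀, h⟩ := exists_forall_norm_systemAverage_sub_le hΦ hΨ a b h1 hn hS f (half_pos hε)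
  filter_upwards [eventually_ge_atTop β₀] with β hβ
  rw [dist_comm, dist_eq_norm]
  refine lt_of_le_of_lt ?_ (half_lt_self hε)
  exact le_of_tendsto (hL.sub_const _).norm
    ((eventually_ge_atTop α₀).mono fun α hα => h α hα β hβ)

/-- Averages along all Følner nets, indexed by types of a fixed universe, have a common limit. -/
theorem exists_tendsto_systemAverage {S : Finset (Γ → koopmanGroup P)} (h1 : 1 ∈ S) {n : ℕ}
    (hn : ComplexityLE n S) (hS : ∀ h ∈ S, IsMeasurableMap μ h)
    (f : (Γ → koopmanGroup P) → unitBall P) :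
    ∃ L : Lp ℂ 2 P, ∀ (A : Type*) [Preorder A] [IsDirectedOrder A] [Nonempty A]
      (Φ : A → Set Γ), IsFolnerNet μ Φ → ∀ a : A → Γ,
        Tendsto (fun α => systemAverage μ S f (a α • Φ α)) atTop (𝓝 L) := by
  by_cases hex : ∃ (A : Type _) (_ : Preorder A) (_ : IsDirectedOrder A) (_ : Nonempty A)
      (Φ : A → Set Γ), IsFolnerNet μ Φ
  · obtain ⟨A, _, _, _, Φ, hΦ⟩ := hex
    obtain ⟨L, hL⟩ := exists_tendsto_systemAverage_of_isFolnerNet hΦ 1 h1 hn hS f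
    exact ⟨L, fun B _ _ _ Ψ hΨ b => tendsto_systemAverage_of_tendsto hΦ hΨ 1 b h1 hn hS f hL⟩
  · exact ⟨0, fun A _ _ _ Φ hΦ => (hex ⟨A, _, ‹_›, ‹_›, Φ, hΦ⟩).elim⟩

end Folner

/-! ### Reduction to functions in the unit ball -/

section Normalization

variable {X : Type*} [MeasurableSpace X] {P : Measure X} [IsProbabilityMeasure P]

theorem exists_linftyToL2_eq_smul_toL2 {C : ℝ} (hC : 0 < C) (f : Lp ℂ ∞ P) (hf : ‖f‖ ≤ C) :
    ∃ b : unitBall P, linftyToL2 f = (C : ℂ) • toL2 b := by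
  have hbound : ∀ᵐ x ∂P, ‖f x‖ ≤ C := by
    have h := eLpNorm_exponent_top (f := f) (μ := P)
    filter_upwards [ae_le_eLpNormEssSup (f := f) (μ := P)] with x hx
    rw [← h, ← Lp.enorm_def] at hx
    have h2 : ‖f x‖ ≤ ‖f‖ := by
      rw [enorm_eq_nnnorm, enorm_eq_nnnorm, ENNReal.coe_le_coe] at hx
      exact_mod_cast hx
    exact h2.trans hf
  have hC' : (C : ℂ) ≠ 0 := by exact_mod_cast hC.ne'
  obtain ⟨b, hb⟩ := exists_toL2_eq (v := (C : ℂ)⁻¹ • linftyToL2 f) (by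
    filter_upwards [hbound, coeFn_linftyToL2 f, Lp.coeFn_smul (C : ℂ)⁻¹ (linftyToL2 f)]
      with x h1 h2 h3
    rw [h3, Pi.smul_apply, h2, norm_smul, norm_inv, Complex.norm_of_nonneg hC.le]
    exact (inv_mul_le_one₀ hC).2 h1)
  exact ⟨b, by rw [hb, smul_inv_smul₀ hC']⟩

theorem multipleProduct_eq_smul_toL2 {j : ℕ} (T : Fin j → koopmanGroup P)
    {f : Fin (j + 1) → Lp ℂ ∞ P} {C : ℂ} {b : Fin (j + 1) → unitBall P}
    (hb : ∀ i, linftyToL2 (f i) = C • toL2 (b i)) :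
    multipleProduct T f = C ^ (j + 1) • toL2 (b 0 * ∏ i : Fin j, T i • b i.succ) := by
  have hT : ∀ i : Fin j, (T i).1 (linftyToL2 (f i.succ)) = C • toL2 (T i • b i.succ) := fun i => by
    rw [hb, map_smul, toL2_smul]
  refine Lp.ext ?_
  have h0 : ∀ᵐ x ∂P, ∀ i : Fin j,
      (C • toL2 (T i • b i.succ)) x = C * (T i • b i.succ).1 x :=
    ae_all_iff.2 fun i => Lp.coeFn_smul C (toL2 (T i • b i.succ))
  have hprod : (b 0 * ∏ i : Fin j, T i • b i.succ).1 =ᵐ[P]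
      fun x => (b 0).1 x * ∏ i : Fin j, (T i • b i.succ).1 x := by
    have e : (b 0 * ∏ i : Fin j, T i • b i.succ).1 =
        (b 0).1 * ∏ i : Fin j, (T i • b i.succ).1 := by
      rw [Submonoid.coe_mul, Submonoid.coe_finsetProd]
    rw [e]
    filter_upwards [AEEqFun.coeFn_mul (b 0).1 (∏ i : Fin j, (T i • b i.succ).1),
      AEEqFun.coeFn_finsetProd Finset.univ (fun i : Fin j => (T i • b i.succ).1)] with x h1 h2
    rw [h1, Pi.mul_apply, h2, Finset.prod_apply]
  have hb0 := hb 0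
  filter_upwards [MemLp.coeFn_toLp (memLp_multipleProduct T f), coeFn_linftyToL2 (f 0), h0, hprod,
    Lp.coeFn_smul C (toL2 (b 0)), Lp.coeFn_smul (C ^ (j + 1))
      (toL2 (b 0 * ∏ i : Fin j, T i • b i.succ))] with x h1 h2 h3 h4 h5 h6
  have h7 : f 0 x = C * (b 0).1 x := by
    rw [← h2, hb0, h5]; rfl
  refine h1.trans (Eq.trans ?_ h6.symm)
  rw [h7]
  simp only [hT, h3]
  rw [Finset.prod_mul_distrib, Finset.prod_const, Finset.card_univ, Fintype.card_fin]
  change _ = C ^ (j + 1) * (b 0 * ∏ i : Fin j, T i • b i.succ).1 x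
  rw [h4]
  ring

end Normalization

/-- Norm convergence of multiple averages along measurable polynomial maps `g₁, …, g_j` from a
locally compact group `Γ` with left Haar measure `μ` to a group `G = F 0` of unitary operators with
a filtration `F` of length `d`. Products `f₀ · g₁(m) f₁ ⋯ g_j(m) f_j` are integrable over compact
sets, and their averages over `a_α Φ_α` converge in `L²(X)` to one and the same limit for all Følner
nets `Φ` and all shifts `a`. (Amenability of `Γ` means that Følner nets exist.) -/
theorem mainTheorem3
    {Γ : Type*} [Group Γ] [TopologicalSpace Γ] [IsTopologicalGroup Γ] [LocallyCompactSpace Γ]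
    [T2Space Γ] [MeasurableSpace Γ] [BorelSpace Γ]
    (μ : Measure Γ) [μ.IsHaarMeasure] [μ.Regular]
    {X : Type*} [MeasurableSpace X] (P : Measure X) [IsProbabilityMeasure P]
    (F : ℕ → Subgroup (koopmanGroup P)) (hF : IsGroupFiltration F) (d : ℕ) (hd : F (d + 1) = ⊥)
    (j : ℕ) (g : Fin j → Γ → koopmanGroup P)
    (hpoly : ∀ i, IsPolynomial (d + 1) F (g i)) (hmeas : ∀ i, IsMeasurableMap μ (g i))
    (f : Fin (j + 1) → Lp ℂ ∞ P) :
    (∀ K : Set Γ, IsCompact K →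
      IntegrableOn (fun m => multipleProduct (fun i => g i m) f) K μ) ∧
    ∃ L : Lp ℂ 2 P, ∀ (A : Type*) [Preorder A] [IsDirectedOrder A] [Nonempty A]
      (Φ : A → Set Γ), IsFolnerNet μ Φ → ∀ a : A → Γ,
        Tendsto (fun α => ⨍ m in a α • Φ α, multipleProduct (fun i => g i m) f ∂μ)
          atTop (𝓝 L) := by
  classical
  -- The factor `f₀` belongs to the constant map `1`.
  set ψ : Fin (j + 1) → Γ → koopmanGroup P := Fin.cons 1 g with hψ
  set S : Finset (Γ → koopmanGroup P) := Finset.univ.image ψ with hS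
  have h1 : 1 ∈ S := Finset.mem_image.2 ⟨0, Finset.mem_univ _, by rw [hψ, Fin.cons_zero]⟩
  have hS0 : ∀ h ∈ S, h ∈ polySubgroup (Γ := Γ) hF 0 := by
    intro h hh
    obtain ⟨i, -, rfl⟩ := Finset.mem_image.1 hh
    refine Fin.cases ?_ (fun i => ?_) i
    · rw [hψ, Fin.cons_zero]; exact one_mem _
    · rw [hψ, Fin.cons_succ]; exact (hpoly i).mem_polySubgroup hF
  have hSm : ∀ h ∈ S, IsMeasurableMap μ h := by
    intro h hh
    obtain ⟨i, -, rfl⟩ := Finset.mem_image.1 hh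
    refine Fin.cases ?_ (fun i => ?_) i
    · rw [hψ, Fin.cons_zero]
      exact fun _ _ _ => ⟨aestronglyMeasurable_const, aestronglyMeasurable_const⟩
    · rw [hψ, Fin.cons_succ]; exact hmeas i
  obtain ⟨n, hn⟩ := exists_complexityLE (polySubgroup_antitone hF)
    (fun s r hr a b => derivative_mem_polySubgroup hF hr a b) (polySubgroup_eq_bot hF hd) h1 hS0
  obtain ⟨C, hC0, hC⟩ : ∃ C : ℝ, 0 < C ∧ ∀ i, ‖f i‖ ≤ C :=
    ⟨1 + ∑ i, ‖f i‖, by positivity, fun i => (Finset.single_le_sum (f := fun i => ‖f i‖)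
      (fun _ _ => norm_nonneg _) (Finset.mem_univ i)).trans (by linarith)⟩
  choose b hb using fun i => exists_linftyToL2_eq_smul_toL2 hC0 (f i) (hC i)
  obtain ⟨φ, hφ⟩ := exists_systemProduct_image Finset.univ ψ b
  have key : ∀ m, multipleProduct (fun i => g i m) f =
      (C : ℂ) ^ (j + 1) • toL2 (systemProduct S φ m) := by
    intro m
    rw [multipleProduct_eq_smul_toL2 _ hb, hS, hφ, Fin.prod_univ_succ]
    simp only [hψ, Fin.cons_zero, Fin.cons_succ, Pi.one_apply, one_smul]
  simp only [key]
  refine ⟨fun K hK => ?_, ?_⟩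
  · have : IsFiniteMeasure (μ.restrict K) := ⟨by
      rw [Measure.restrict_apply_univ]; exact hK.measure_lt_top⟩
    exact Integrable.fun_smul _ <| Integrable.of_bound
      (aestronglyMeasurable_systemProduct hSm φ hK) 1 (Eventually.of_forall fun m => norm_toL2_le _)
  · obtain ⟨L, hL⟩ := exists_tendsto_systemAverage h1 hn hSm φ
    refine ⟨(C : ℂ) ^ (j + 1) • L, fun A _ _ _ Φ hΦ a => ?_⟩
    simp only [setAverage_eq_integral_cond, integral_smul]
    exact (hL A Φ hΦ a).const_smul _
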